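/- Let $\mathbb{N}=\{1,2,3,\dots\}$. **Lawlessness growth.** For nondecreasing $F_1,F_2:\mathbb{N}\to\mathbb{N}\cup\{0,\infty\}$ write $F_1\preceq F_2$ if there is $K\in\mathbb{N}$ with $F_1(l)\le K F_2(Kl)$ for all $l\in\mathbb N$, and $F_1\approx F_2$ if $F_1\preceq F_2$ and $F_2\preceq F_1$. A law for a group $\Gamma$ is a nontrivial $w\in F_k$ (for some $k$) killed by every homomorphism $F_k\to\Gamma$; $\Gamma$ is lawless if it has no laws. For $\Gamma$ generated by $S$ and $k\ge 2$, $\mathcal A^S_{\Gamma}(l)$ is the maximum, over nontrivial $w\in F_k$ with $|w|\le l$, of $\chi(w)=\min\{\sum_{i=1}^k|g_i|_S : g_i\in\Gamma,\ w(g_1,\dots,g_k)\ne e\}$. Elementary amenable groups are the smallest class of groups containing the finite groups and $\mathbb Z$ and closed under subgroups, quotients, extensions and directed limits. **Sparse wreath products.** Let $p,q:\mathbb N\to\mathbb N\cup\{0\}$ be nondecreasing with $p(1)=q(1)=0$ and, for all $n$, $$p(n+1)\ge p(n)+q(n)+1,\qquad q(n+1)\ge p(n+1)+q(n)+1, \tag{a}$$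 and let $L:\mathbb N\to\mathbb N$ satisfy $$L(n+1)\ge 64L(n)+29\quad\text{for all } n. \tag{b}$$ Let $p_n$ be the smallest prime with $L(n)<(p_n-1)/3$, let $W_n=\{w\in F_2\setminus\{1\}:|w|<(p_n-1)/3\}$ and $\Delta=\bigoplus_{n\ge1}\mathrm{PSL}_2(p_n)^{W_n}$. Call a choice of elements $g_n,h_n\in \mathrm{PSL}_2(p_n)^{W_n}$ ($n\in\mathbb N$) admissible if $w(g_n,h_n)\neq e$ for all $n$ and all $w\in W_n$. Given an admissible choice, define $\hat g,\hat h:\mathbb Z\to\Delta$ by $\hat g(p(n))=g_n$, $\hat h(q(n))=h_n$ for $n\in\mathbb N$ (in the $n$-th summand of $\Delta$), all other values being $e$. The associated sparse wreath product is the subgroup $\Gamma(L)$ generated by $S(L)=\{\hat g,\hat h,t\}$ in the unrestricted wreath product $\Delta^{\mathbb Z}\rtimes\langle t\rangle$, $\langle t\rangle\cong\mathbb Z$. **Theorem.** Let $p,q$ satisfy (a), let $L$ satisfy (b), and let $f:\mathbb N\to\mathbb N\cup\{0\}$ be unbounded and nondecreasing. Suppose there are constants $K,C\in\mathbb N$ such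 that (i) $K\,(q(Km)-p(Km))/2\ \ge\ f(L(m+1))$ for all $m\ge2$, and (ii) $C f(C L(m))\ \ge\ 2\,(q(m+1)-p(m+1)+1)$ for all $m\ge1$. Then there is an elementary amenable lawless group $\Gamma$ with a finite generating set $S$ such that $\mathcal A^S_\Gamma\approx f$ (for every $k\ge 2$). Moreover, $\Gamma$ can be taken to be a sparse wreath product, with generating set $\{\hat g,\hat h,t\}$, for suitable data $p',q',L'$ satisfying (a) and (b) and an admissible choice of elements. As for the given data $p,q,L$: an admissible choice exists, and for every admissible choice $\Gamma(L)$ is elementary amenable and lawless, with $\mathcal A^{S(L)}_{\Gamma(L)}\preceq f$ for every $k\ge2$. If moreover there is a constant $K'\in\mathbb N$ with $K'(q(m)-p(m))/2\ge f(L(m+1))$ for all $m\ge2$ (as is the case if $K=1$ in (i)), then $\mathcal A^{S(L)}_{\Gamma(L)}\approx f$ for every $k\ge2$. -/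

import Mathlib

noncomputable section

namespace SparseWreath

/-! ### Growth functions

The natural numbers `{1, 2, 3, …}` on which growth functions live are `ℕ+`. -/

/-- `F₁ ≼ F₂`: there is a positive integer `K` with `F₁ l ≤ K * F₂ (K * l)` for all `l`. -/
def Dominated (F₁ F₂ : ℕ+ → ℕ∞) : Prop :=
  ∃ K : ℕ+, ∀ l : ℕ+, F₁ l ≤ ((K : ℕ) : ℕ∞) * F₂ (K * l)

/-- `F₁ ≈ F₂`: each function dominates the other. -/
def GrowthEquiv (F₁ F₂ : ℕ+ → ℕ∞) : Prop :=
  Dominated F₁ F₂ ∧ Dominated F₂ F₁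

/-! ### Laws and lawlessness growth -/

section Laws

variable {G : Type*} [Group G]

/-- The value `w(g₁, …, g_k)` of a word of the free group of rank `k`. -/
def wordValue {k : ℕ} (w : FreeGroup (Fin k)) (g : Fin k → G) : G :=
  FreeGroup.lift g w

variable (G) in
/-- `w` is a law for `G`: it is nontrivial and is killed by every homomorphism from the free group
to `G`. -/
def IsLaw {k : ℕ} (w : FreeGroup (Fin k)) : Prop :=
  w ≠ 1 ∧ ∀ g : Fin k → G, wordValue w g = 1

variable (G) in
/-- A group is lawless if it has no laws, in any number of variables. -/
def IsLawless : Prop :=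
  ∀ (k : ℕ) (w : FreeGroup (Fin k)), ¬ IsLaw G w

/-- Word length of `g` with respect to `S`: the least length of a product of elements of `S` and
their inverses that equals `g` (and `⊤` if there is no such product). -/
def wordLength (S : Set G) (g : G) : ℕ∞ :=
  ⨅ (l : List G) (_ : (∀ s ∈ l, s ∈ S ∨ s⁻¹ ∈ S) ∧ l.prod = g), (l.length : ℕ∞)

/-- The complexity of `w` in `G` with respect to `S`: the least total word length of a tuple at
which `w` does not vanish (and `⊤` if `w` vanishes everywhere). -/
def complexity (S : Set G) {k : ℕ} (w : FreeGroup (Fin k)) : ℕ∞ :=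
  ⨅ (g : Fin k → G) (_ : wordValue w g ≠ 1), ∑ i, wordLength S (g i)

/-- The lawlessness growth function of `G` with respect to `S`, on words in `k` variables: the
largest complexity of a nontrivial word of length at most `l`. -/
def lawlessnessGrowth (S : Set G) (k : ℕ) (l : ℕ+) : ℕ∞ :=
  ⨆ (w : FreeGroup (Fin k)) (_ : w ≠ 1 ∧ w.norm ≤ (l : ℕ)), complexity S w

end Laws

/-! ### Elementary amenable groups -/

/-- The class of elementary amenable groups: the smallest class containing the finite groups and
`ℤ` and closed under subgroups, quotients, extensions and directed limits. -/
inductive IsElementaryAmenable : ∀ (G : Type) [Group G], Prop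
  | of_finite (G : Type) [Group G] [Finite G] : IsElementaryAmenable G
  | int : IsElementaryAmenable (Multiplicative ℤ)
  | of_injective {G H : Type} [Group G] [Group H] (φ : H →* G) (hφ : Function.Injective φ)
      (hG : IsElementaryAmenable G) : IsElementaryAmenable H
  | of_surjective {G H : Type} [Group G] [Group H] (φ : G →* H) (hφ : Function.Surjective φ)
      (hG : IsElementaryAmenable G) : IsElementaryAmenable H
  | extension {G : Type} [Group G] (N : Subgroup G) [N.Normal]
      (hN : IsElementaryAmenable N) (hQ : IsElementaryAmenable (G ⧸ N)) : IsElementaryAmenable G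
  | directLimit {ι : Type} [Preorder ι] [IsDirectedOrder ι] [Nonempty ι]
      (G : ι → Type) [∀ i, Group (G i)] (f : ∀ i j, i ≤ j → G i →* G j)
      [DirectedSystem G (fun i j h => f i j h)] (hG : ∀ i, IsElementaryAmenable (G i)) :
      IsElementaryAmenable (DirectLimit G f)

/-! ### The base group `Δ = ⨁ₙ PSL₂(pₙ) ^ Wₙ` -/

/-- The direct sum (restricted direct product) of a family of groups: the elements of the full
product with only finitely many nontrivial coordinates. -/
def directSum {ι : Type} (H : ι → Type) [∀ i, Group (H i)] : Subgroup (∀ i, H i) where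
  carrier := {x | {i | x i ≠ 1}.Finite}
  one_mem' := by simp
  mul_mem' := by
    intro a b ha hb
    refine (Set.Finite.union ha hb).subset ?_
    intro i hi
    by_contra h
    simp only [Set.mem_union, Set.mem_ofPred_eq, not_or, not_not] at h
    exact hi (by simp [h.1, h.2])
  inv_mem' := by
    intro a ha
    simpa using ha

open Classical in
/-- The element of the direct sum with `i`-th coordinate `x` and all others trivial. -/
def directSum.single {ι : Type} (H : ι → Type) [∀ i, Group (H i)] (i : ι) (x : H i) :
    directSum H :=
  ⟨Pi.mulSingle i x, (Set.finite_singleton i).subset fun j hj => by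
    by_contra h
    exact hj (Pi.mulSingle_eq_of_ne h x)⟩

/-- The smallest prime `r` with `l < (r - 1) / 3`. -/
def sparsePrime (l : ℕ+) : ℕ :=
  sInf {r : ℕ | r.Prime ∧ ((l : ℕ) : ℝ) < ((r : ℝ) - 1) / 3}

/-- The nontrivial words in two variables of length less than `(r - 1) / 3`. -/
def ShortWord (r : ℕ) : Type :=
  {w : FreeGroup (Fin 2) // w ≠ 1 ∧ (w.norm : ℝ) < ((r : ℝ) - 1) / 3}

/-- The group `PSL₂(r) ^ W` with `W` the set of short words for `r`. -/
abbrev Factor (r : ℕ) : Type :=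
  ShortWord r → Matrix.ProjectiveSpecialLinearGroup (Fin 2) (ZMod r)

/-- The factor of index `n`, for the prime `pₙ` determined by `L n`. -/
abbrev LFactor (L : ℕ+ → ℕ+) (n : ℕ+) : Type :=
  Factor (sparsePrime (L n))

/-- `Δ = ⨁ₙ PSL₂(pₙ) ^ Wₙ`. -/
abbrev Base (L : ℕ+ → ℕ+) : Type :=
  directSum (LFactor L)

/-- The pairs `g n, h n ∈ PSL₂(pₙ) ^ Wₙ` satisfy `w (g n, h n) ≠ e` for every `w ∈ Wₙ`. -/
def IsAdmissible (L : ℕ+ → ℕ+) (g h : ∀ n, LFactor L n) : Prop :=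
  ∀ (n : ℕ+) (w : ShortWord (sparsePrime (L n))), wordValue w.1 ![g n, h n] ≠ 1

/-! ### Sparse wreath products -/

/-- The growth conditions on `p` and `q`. -/
structure GrowthConditions (p q : ℕ+ → ℕ) : Prop where
  monotone_p : Monotone p
  monotone_q : Monotone q
  p_one : p 1 = 0
  q_one : q 1 = 0
  p_succ : ∀ n, p n + q n + 1 ≤ p (n + 1)
  q_succ : ∀ n, p (n + 1) + q n + 1 ≤ q (n + 1)

/-- The function `ℤ → Δ` with value `x n` (in the `n`-th summand of `Δ`) at the integer `r n`, and
trivial off the image of `r`. It is used only for injective `r`. -/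
def spread (L : ℕ+ → ℕ+) (r : ℕ+ → ℕ) (x : ∀ n, LFactor L n) : ℤ → Base L :=
  Function.extend (fun n => (r n : ℤ)) (fun n => directSum.single (LFactor L) n (x n)) 1

/-- The unrestricted wreath product `Δ ≀ ℤ = Δ ^ ℤ ⋊ ℤ`. -/
abbrev Ambient (L : ℕ+ → ℕ+) : Type :=
  Base L ≀ᵣ Multiplicative ℤ

/-- A function `ℤ → Δ` as an element of the wreath product. -/
def ofFun {L : ℕ+ → ℕ+} (φ : ℤ → Base L) : Ambient L :=
  ⟨fun z => φ z.toAdd, 1⟩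

/-- The generator `t` of the factor `ℤ`. -/
def shift (L : ℕ+ → ℕ+) : Ambient L :=
  ⟨1, Multiplicative.ofAdd 1⟩

/-- The set `{ĝ, ĥ, t}` in the wreath product. -/
def ambientGenerators (p q : ℕ+ → ℕ) (L : ℕ+ → ℕ+) (g h : ∀ n, LFactor L n) : Set (Ambient L) :=
  {ofFun (spread L p g), ofFun (spread L q h), shift L}

/-- The sparse wreath product `Γ(L) = ⟨ĝ, ĥ, t⟩`. -/
abbrev Gamma (p q : ℕ+ → ℕ) (L : ℕ+ → ℕ+) (g h : ∀ n, LFactor L n) : Type :=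
  Subgroup.closure (ambientGenerators p q L g h)

/-- The generating set `S(L) = {ĝ, ĥ, t}` as a subset of `Γ(L)`. -/
def generators (p q : ℕ+ → ℕ) (L : ℕ+ → ℕ+) (g h : ∀ n, LFactor L n) : Set (Gamma p q L g h) :=
  {x | (x : Ambient L) ∈ ambientGenerators p q L g h}

end SparseWreath

end

namespace SparseWreath

open scoped commutatorElement

/-! ### Words and free groups -/

section Words

variable {G H : Type*} [Group G] [Group H]

/-! The gap `q n - p n` measures how far the generators must be moved before `g n` and `h n` meet in
the `n`-th summand of `Δ`. Both bounds on the growth express that meeting is necessary and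
sufficient.

Upper bound: conjugating `ĥ` by a power of `t` of exponent `q n - p n` puts `h n` on top of `g n`.
By admissibility, no nontrivial word in two letters of length at most `L n` vanishes on `ĝ` and this
conjugate. A free group of rank `k` embeds in one of rank two through the words `y ^ i * x * y ^
(-i)`, so for each `k` the complexity of a word whose length is at most a constant multiple of `L n`
is linear in the gap. This also gives lawlessness. That `PSL₂(r)` satisfies no short law is seen by
specializing two matrices over `F[X]`: the value of a word has entries of degree at most its length,
and too few roots to be scalar at every point.

Lower bound: an element of `PSL₂(r)` is killed by `r`, `r - 1` or `r + 1`, which yields a law of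
length linear in `r`. Nested commutators of such laws, kept linear in `L m` by the geometric growth
of `L`, give a word `v` that is a law for the first `m` summands and for all commuting pairs.
Elements of length `N` with `2 * N` less than the gap see at most one of `g n`, `h n` at each
position, so their coordinates commute there. Evaluating `v` at `[x, y]` and `[x, y²]`, which lie in
the base group, gives a word that vanishes until the length is of the order of the gap at `m + 1`.

Amenability: over `ℤ`, the kernel is locally finite by abelian, since a commutator is trivial in
every summand whose gap is large. The matching with `f` is then arithmetic: `exists_data` chooses
the gaps as values of `f` along a sequence on which `f` at least quadruples. -/

theorem map_wordValue (φ : G →* H) {k : ℕ} (w : FreeGroup (Fin k)) (g : Fin k → G) :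
    φ (wordValue w g) = wordValue w (fun i => φ (g i)) := by
  have : φ.comp (FreeGroup.lift g) = FreeGroup.lift (fun i => φ (g i)) := by
    ext i; simp
  exact DFunLike.congr_fun this w

theorem wordValue_lift {k m : ℕ} (s : Fin k → FreeGroup (Fin m)) (w : FreeGroup (Fin k))
    (g : Fin m → G) :
    wordValue (FreeGroup.lift s w) g = wordValue w (fun i => wordValue (s i) g) :=
  map_wordValue (FreeGroup.lift g) w s

theorem norm_prod_le {α : Type*} [DecidableEq α] (C : ℕ) (l : List (FreeGroup α))
    (h : ∀ x ∈ l, x.norm ≤ C) : l.prod.norm ≤ C * l.length := by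
  induction l with
  | nil => simp
  | cons a l ih =>
    have h1 := h a (by simp)
    have h2 := ih fun x hx => h x (by simp [hx])
    have h3 := FreeGroup.norm_mul_le a l.prod
    simp only [List.prod_cons, List.length_cons]
    linarith

theorem norm_lift_le {α β : Type*} [DecidableEq α] [DecidableEq β] (s : α → FreeGroup β) (C : ℕ)
    (h : ∀ i, (s i).norm ≤ C) (w : FreeGroup α) : (FreeGroup.lift s w).norm ≤ C * w.norm := by
  conv_lhs => rw [← FreeGroup.mk_toWord (x := w)]
  rw [FreeGroup.lift_mk]
  refine (norm_prod_le C _ ?_).trans (by simp [FreeGroup.norm])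
  intro x hx
  obtain ⟨⟨i, b⟩, -, rfl⟩ := List.mem_map.mp hx
  cases b <;> simp [FreeGroup.norm_inv_eq, h]

theorem norm_map_le {α β : Type*} [DecidableEq α] [DecidableEq β] (s : α → β)
    (w : FreeGroup α) : (FreeGroup.map s w).norm ≤ w.norm := by
  rw [FreeGroup.map_eq_lift]
  simpa [Function.comp_def] using norm_lift_le (fun i => FreeGroup.of (s i)) 1 (by simp) w

theorem norm_commutator_le {α : Type*} [DecidableEq α] (x y : FreeGroup α) :
    ⁅x, y⁆.norm ≤ 2 * (x.norm + y.norm) := by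
  have h1 := FreeGroup.norm_mul_le (x * y * x⁻¹) y⁻¹
  have h2 := FreeGroup.norm_mul_le (x * y) x⁻¹
  have h3 := FreeGroup.norm_mul_le x y
  rw [FreeGroup.norm_inv_eq] at h1 h2
  rw [commutatorElement_def]
  linarith

theorem norm_zpow_of_le {α : Type*} [DecidableEq α] (a : α) (n : ℤ) :
    (FreeGroup.of a ^ n).norm ≤ n.natAbs := by
  obtain ⟨m, rfl | rfl⟩ := n.eq_nat_or_neg <;>
    simp [FreeGroup.norm_inv_eq, FreeGroup.norm_of_pow, -FreeGroup.norm_of]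

/-- Commutators of nontrivial words in disjoint sets of variables are nontrivial. -/
theorem commutator_inl_inr_ne_one {α β : Type*} {u : FreeGroup α} {v : FreeGroup β}
    (hu : u ≠ 1) (hv : v ≠ 1) :
    ⁅FreeGroup.map (Sum.inl : α → α ⊕ β) u, FreeGroup.map (Sum.inr : β → α ⊕ β) v⁆ ≠ 1 := by
  classical
  -- `u` acts on the line `z.2 = 1` of the product and `v` on the line `z.1 = 1`.
  let X := FreeGroup α × FreeGroup β
  let A : FreeGroup α →* Equiv.Perm X :=
    { toFun := fun x => ⟨fun z => if z.2 = 1 then (x * z.1, z.2) else z,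
        fun z => if z.2 = 1 then (x⁻¹ * z.1, z.2) else z,
        fun ⟨a, b⟩ => by by_cases h : b = 1 <;> simp [h],
        fun ⟨a, b⟩ => by by_cases h : b = 1 <;> simp [h]⟩
      map_one' := by ext z : 1; simp
      map_mul' := fun x y => by
        ext z : 1
        by_cases h : z.2 = 1 <;> simp [h, mul_assoc] }
  let B : FreeGroup β →* Equiv.Perm X :=
    { toFun := fun x => ⟨fun z => if z.1 = 1 then (z.1, x * z.2) else z,
        fun z => if z.1 = 1 then (z.1, x⁻¹ * z.2) else z,
        fun ⟨a, b⟩ => by by_cases h : a = 1 <;> simp [h],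
        fun ⟨a, b⟩ => by by_cases h : a = 1 <;> simp [h]⟩
      map_one' := by ext z : 1; simp
      map_mul' := fun x y => by
        ext z : 1
        by_cases h : z.1 = 1 <;> simp [h, mul_assoc] }
  let Φ : FreeGroup (α ⊕ β) →* Equiv.Perm X :=
    FreeGroup.lift (Sum.elim (fun a => A (FreeGroup.of a)) (fun b => B (FreeGroup.of b)))
  have hA : Φ (FreeGroup.map Sum.inl u) = A u := by
    have : Φ.comp (FreeGroup.map Sum.inl) = A := by ext a : 1; simp [Φ]
    exact DFunLike.congr_fun this u
  have hB : Φ (FreeGroup.map Sum.inr v) = B v := by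
    have : Φ.comp (FreeGroup.map Sum.inr) = B := by ext a : 1; simp [Φ]
    exact DFunLike.congr_fun this v
  -- The two lines meet only at `(1, 1)`. From there, `v` followed by `u` leads to `(1, v)`, whereas
  -- `u` followed by `v` leads to `(u, 1)`.
  intro h
  rw [commutatorElement_eq_one_iff_mul_comm] at h
  have h2 := congrArg (fun w => Φ w (1, 1)) h
  simp only [map_mul, hA, hB, Equiv.Perm.mul_apply] at h2
  simp [A, B, hu, hv] at h2
  exact hv (congrArg Prod.snd h2)

/-- A function on `ℤ` as an element of the unrestricted wreath product. -/
def lamp (D : Type*) [Group D] : (ℤ → D) →* D ≀ᵣ Multiplicative ℤ where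
  toFun φ := ⟨fun z => φ z.toAdd, 1⟩
  map_one' := rfl
  map_mul' φ ψ := by ext <;> simp

theorem lamp_conj {D : Type*} [Group D] (n : ℤ) (φ : ℤ → D) :
    (⟨1, Multiplicative.ofAdd 1⟩ : D ≀ᵣ Multiplicative ℤ) ^ n * lamp D φ *
      ((⟨1, Multiplicative.ofAdd 1⟩ : D ≀ᵣ Multiplicative ℤ) ^ n)⁻¹ =
    lamp D (fun z => φ (z - n)) := by
  have : (⟨1, Multiplicative.ofAdd 1⟩ : D ≀ᵣ Multiplicative ℤ) ^ n =
      RegularWreathProduct.inl (Multiplicative.ofAdd n) := by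
    rw [show (⟨1, Multiplicative.ofAdd 1⟩ : D ≀ᵣ Multiplicative ℤ) =
      RegularWreathProduct.inl (Multiplicative.ofAdd 1) from rfl, ← map_zpow, ← ofAdd_zsmul]
    simp
  rw [this]
  ext z
  · simp [lamp, sub_eq_neg_add]
  · simp [lamp]

/-- The words `y ^ (j i) * x * y ^ (- j i)` in the free group on `x, y`. -/
def conjWord {ι : Type*} (j : ι → ℤ) (i : ι) : FreeGroup (Fin 2) :=
  FreeGroup.of 1 ^ j i * FreeGroup.of 0 * (FreeGroup.of 1 ^ j i)⁻¹

theorem norm_conjWord_le {ι : Type*} (j : ι → ℤ) (i : ι) :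
    (conjWord j i).norm ≤ 2 * (j i).natAbs + 1 := by
  have h1 := FreeGroup.norm_mul_le (FreeGroup.of (1 : Fin 2) ^ j i * FreeGroup.of 0)
    (FreeGroup.of 1 ^ j i)⁻¹
  have h2 := FreeGroup.norm_mul_le (FreeGroup.of (1 : Fin 2) ^ j i) (FreeGroup.of 0)
  have h3 := norm_zpow_of_le (1 : Fin 2) (j i)
  rw [FreeGroup.norm_inv_eq] at h1
  rw [FreeGroup.norm_of] at h2
  rw [conjWord]
  linarith

/-- Distinct conjugates of `x` by powers of `y` freely generate a free group. -/
theorem lift_conjWord_injective {ι : Type*} (j : ι → ℤ) (hj : Function.Injective j) :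
    Function.Injective (FreeGroup.lift (conjWord j)) := by
  rw [injective_iff_map_eq_one]
  intro w hw
  -- A left inverse is read off in a wreath product: `x` carries the `i`-th free generator at
  -- position `-j i`, and conjugation by `y ^ j i` brings exactly that generator to position `0`.
  let φ : ℤ → FreeGroup ι := Function.extend (fun i => - j i) FreeGroup.of 1
  let Φ : FreeGroup (Fin 2) →* FreeGroup ι ≀ᵣ Multiplicative ℤ :=
    FreeGroup.lift ![lamp _ φ, ⟨1, Multiplicative.ofAdd 1⟩]
  have h1 : Φ.comp (FreeGroup.lift (conjWord j)) =
      (lamp (FreeGroup ι)).comp (FreeGroup.lift fun i z => φ (z - j i)) := by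
    ext i : 1
    simp only [MonoidHom.comp_apply, FreeGroup.lift_apply_of, ← lamp_conj]
    simp [Φ, conjWord]
  have h2 : (FreeGroup.lift fun (i : ι) (z : ℤ) => φ (z - j i)) w 0 = w := by
    have : (Pi.evalMonoidHom (fun _ : ℤ => FreeGroup ι) 0).comp
        (FreeGroup.lift fun (i : ι) (z : ℤ) => φ (z - j i)) = MonoidHom.id _ := by
      ext i : 1
      have hj' : Function.Injective fun i => - j i := neg_injective.comp hj
      simp only [MonoidHom.comp_apply, FreeGroup.lift_apply_of, Pi.evalMonoidHom_apply, zero_sub,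
        MonoidHom.id_apply, φ]
      exact hj'.extend_apply _ _ i
    exact DFunLike.congr_fun this w
  have h3 := DFunLike.congr_fun h1 w
  simp only [MonoidHom.comp_apply, hw, map_one] at h3
  have h4 := congrArg (fun x : FreeGroup ι ≀ᵣ Multiplicative ℤ => x.left 1) h3
  exact (h4.trans h2).symm

end Words

/-! ### Combining laws -/

section CombineLaws

variable {G : Type*} [Group G]

theorem wordValue_lift_conjWord {ι : Type*} (j : ι → ℤ) (w : FreeGroup ι) (g : Fin 2 → G) :
    wordValue (FreeGroup.lift (conjWord j) w) g =
      FreeGroup.lift (fun i => g 1 ^ j i * g 0 * (g 1 ^ j i)⁻¹) w := by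
  have : (FreeGroup.lift g).comp (FreeGroup.lift (conjWord j)) =
      FreeGroup.lift (fun i => g 1 ^ j i * g 0 * (g 1 ^ j i)⁻¹) := by
    ext i : 1
    simp [conjWord]
  exact DFunLike.congr_fun this w

theorem norm_lift_conjWord_le {ι : Type*} [DecidableEq ι] (j : ι → ℤ) (C : ℕ)
    (hC : ∀ i, (j i).natAbs ≤ C) (w : FreeGroup ι) :
    (FreeGroup.lift (conjWord j) w).norm ≤ (2 * C + 1) * w.norm :=
  norm_lift_le _ _ (fun i => (norm_conjWord_le j i).trans (by have := hC i; omega)) w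

/-- The commutator of two words in disjoint sets of variables. -/
def disjointCommutator {α β : Type*} (u : FreeGroup α) (v : FreeGroup β) : FreeGroup (α ⊕ β) :=
  ⁅FreeGroup.map (Sum.inl : α → α ⊕ β) u, FreeGroup.map (Sum.inr : β → α ⊕ β) v⁆

theorem disjointCommutator_ne_one {α β : Type*} {u : FreeGroup α} {v : FreeGroup β}
    (hu : u ≠ 1) (hv : v ≠ 1) : disjointCommutator u v ≠ 1 :=
  commutator_inl_inr_ne_one hu hv

theorem norm_disjointCommutator_le {α β : Type*} [DecidableEq α] [DecidableEq β]
    (u : FreeGroup α) (v : FreeGroup β) :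
    (disjointCommutator u v).norm ≤ 2 * (u.norm + v.norm) := by
  have h1 := norm_commutator_le (FreeGroup.map (Sum.inl : α → α ⊕ β) u)
    (FreeGroup.map (Sum.inr : β → α ⊕ β) v)
  have h2 := norm_map_le (Sum.inl : α → α ⊕ β) u
  have h3 := norm_map_le (Sum.inr : β → α ⊕ β) v
  rw [disjointCommutator]
  linarith

theorem lift_disjointCommutator {α β : Type*} (s : α ⊕ β → G) (u : FreeGroup α)
    (v : FreeGroup β) : FreeGroup.lift s (disjointCommutator u v) =
      ⁅FreeGroup.lift (s ∘ Sum.inl) u, FreeGroup.lift (s ∘ Sum.inr) v⁆ := by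
  have h1 : (FreeGroup.lift s).comp (FreeGroup.map Sum.inl) = FreeGroup.lift (s ∘ Sum.inl) := by
    ext i : 1; simp
  have h2 : (FreeGroup.lift s).comp (FreeGroup.map Sum.inr) = FreeGroup.lift (s ∘ Sum.inr) := by
    ext i : 1; simp
  rw [disjointCommutator, map_commutatorElement, ← h1, ← h2]
  rfl

/-- The exponents used to embed two copies of the free group of rank two in a third one. -/
def combineExponent : Fin 2 ⊕ Fin 2 → ℤ := Sum.elim ![-1, 0] ![1, 2]

/-- A word which is a law for every group for which `u` or `v` is a law. -/
def combine (u v : FreeGroup (Fin 2)) : FreeGroup (Fin 2) :=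
  FreeGroup.lift (conjWord combineExponent) (disjointCommutator u v)

theorem combine_ne_one {u v : FreeGroup (Fin 2)} (hu : u ≠ 1) (hv : v ≠ 1) : combine u v ≠ 1 := by
  have hj : Function.Injective combineExponent := by
    unfold combineExponent
    decide
  have := (lift_conjWord_injective _ hj).ne (disjointCommutator_ne_one hu hv)
  rwa [map_one] at this

theorem norm_combine_le (u v : FreeGroup (Fin 2)) :
    (combine u v).norm ≤ 10 * (u.norm + v.norm) := by
  -- The factor `10` is `2 * 2 + 1` from the conjugating words times `2` from the commutator.
  have hC : ∀ i, (combineExponent i).natAbs ≤ 2 := by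
    unfold combineExponent
    decide
  have h1 := norm_lift_conjWord_le combineExponent 2 hC (disjointCommutator u v)
  have h2 := norm_disjointCommutator_le u v
  rw [combine]
  linarith

/-- Membership of `a i` and `b i` in the subgroup generated by `g` is what makes the commutator
vanish when `g 0` and `g 1` commute. -/
theorem wordValue_combine (u v : FreeGroup (Fin 2)) (g : Fin 2 → G) :
    ∃ a b : Fin 2 → G, wordValue (combine u v) g = ⁅wordValue u a, wordValue v b⁆ ∧
      ∀ i, a i ∈ Subgroup.closure (Set.range g) ∧ b i ∈ Subgroup.closure (Set.range g) := by
  let s : Fin 2 ⊕ Fin 2 → G := fun i =>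
    g 1 ^ combineExponent i * g 0 * (g 1 ^ combineExponent i)⁻¹
  have hs : ∀ i, s i ∈ Subgroup.closure (Set.range g) := fun i => by
    have h : ∀ i, g i ∈ Subgroup.closure (Set.range g) :=
      fun i => Subgroup.subset_closure (Set.mem_range_self i)
    exact mul_mem (mul_mem (zpow_mem (h 1) _) (h 0)) (inv_mem (zpow_mem (h 1) _))
  refine ⟨s ∘ Sum.inl, s ∘ Sum.inr, ?_, fun i => ⟨hs _, hs _⟩⟩
  rw [combine, wordValue_lift_conjWord, lift_disjointCommutator]
  rfl

theorem wordValue_combine_of_left {u : FreeGroup (Fin 2)} (hu : ∀ g : Fin 2 → G, wordValue u g = 1)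
    (v : FreeGroup (Fin 2)) (g : Fin 2 → G) : wordValue (combine u v) g = 1 := by
  obtain ⟨a, b, h, -⟩ := wordValue_combine u v g
  rw [h, hu, commutatorElement_one_left]

theorem wordValue_combine_of_right (u : FreeGroup (Fin 2)) {v : FreeGroup (Fin 2)}
    (hv : ∀ g : Fin 2 → G, wordValue v g = 1) (g : Fin 2 → G) : wordValue (combine u v) g = 1 := by
  obtain ⟨a, b, h, -⟩ := wordValue_combine u v g
  rw [h, hv, commutatorElement_one_right]

theorem wordValue_mem_closure {k : ℕ} (w : FreeGroup (Fin k)) (g : Fin k → G) :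
    wordValue w g ∈ Subgroup.closure (Set.range g) := by
  rw [wordValue, ← FreeGroup.range_lift_eq_closure]
  exact ⟨w, rfl⟩

theorem wordValue_combine_of_commute (u v : FreeGroup (Fin 2)) (g : Fin 2 → G)
    (hg : Commute (g 0) (g 1)) : wordValue (combine u v) g = 1 := by
  obtain ⟨a, b, h, hab⟩ := wordValue_combine u v g
  rw [h, commutatorElement_eq_one_iff_mul_comm]
  have ha : wordValue u a ∈ Subgroup.closure (Set.range g) :=
    (Subgroup.closure_le _).mpr (by rintro _ ⟨i, rfl⟩; exact (hab i).1) (wordValue_mem_closure u a)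
  have hb : wordValue v b ∈ Subgroup.closure (Set.range g) :=
    (Subgroup.closure_le _).mpr (by rintro _ ⟨i, rfl⟩; exact (hab i).2) (wordValue_mem_closure v b)
  have hcomm : ∀ x ∈ Set.range g, ∀ y ∈ Set.range g, x * y = y * x := by
    rintro _ ⟨i, rfl⟩ _ ⟨j, rfl⟩
    fin_cases i <;> fin_cases j <;> first | rfl | exact hg.eq | exact hg.eq.symm
  have := Subgroup.isMulCommutative_closure hcomm
  exact congrArg Subtype.val (mul_comm' (⟨_, ha⟩ : Subgroup.closure (Set.range g)) ⟨_, hb⟩)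

/-- The exponents used to embed a free group of rank three in one of rank two. -/
def powerExponent : (Unit ⊕ Unit) ⊕ Unit → ℤ :=
  Sum.elim (Sum.elim (fun _ => -1) (fun _ => 0)) (fun _ => 1)

/-- A word which is a law for every group each of whose elements `x` satisfies `x ^ a = 1`,
`x ^ b = 1` or `x ^ c = 1`. -/
def powerLaw (a b c : ℕ) : FreeGroup (Fin 2) :=
  FreeGroup.lift (conjWord powerExponent)
    (disjointCommutator (disjointCommutator (FreeGroup.of () ^ a) (FreeGroup.of () ^ b))
      (FreeGroup.of () ^ c))

theorem of_pow_ne_one {α : Type*} (x : α) {n : ℕ} (hn : n ≠ 0) : FreeGroup.of x ^ n ≠ 1 := by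
  classical
  intro h
  have := FreeGroup.norm_of_pow x n
  rw [h, FreeGroup.norm_one] at this
  exact hn this.symm

theorem powerLaw_ne_one {a b c : ℕ} (ha : a ≠ 0) (hb : b ≠ 0) (hc : c ≠ 0) :
    powerLaw a b c ≠ 1 := by
  have hj : Function.Injective powerExponent := by
    unfold powerExponent
    decide
  have := (lift_conjWord_injective _ hj).ne
    (disjointCommutator_ne_one (disjointCommutator_ne_one (of_pow_ne_one () ha)
      (of_pow_ne_one () hb)) (of_pow_ne_one () hc))
  rwa [map_one] at this

theorem norm_powerLaw_le (a b c : ℕ) : (powerLaw a b c).norm ≤ 12 * (a + b + c) := by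
  have hC : ∀ i, (powerExponent i).natAbs ≤ 1 := by
    unfold powerExponent
    decide
  have h1 := norm_lift_conjWord_le powerExponent 1 hC
    (disjointCommutator (disjointCommutator (FreeGroup.of () ^ a) (FreeGroup.of () ^ b))
      (FreeGroup.of () ^ c))
  have h2 := norm_disjointCommutator_le
    (disjointCommutator (FreeGroup.of () ^ a) (FreeGroup.of () ^ b)) (FreeGroup.of () ^ c)
  have h3 := norm_disjointCommutator_le (FreeGroup.of () ^ a) (FreeGroup.of () ^ b)
  simp only [FreeGroup.norm_of_pow] at h2 h3
  rw [powerLaw]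
  linarith

theorem wordValue_powerLaw {a b c : ℕ} (h : ∀ x : G, x ^ a = 1 ∨ x ^ b = 1 ∨ x ^ c = 1)
    (g : Fin 2 → G) : wordValue (powerLaw a b c) g = 1 := by
  rw [powerLaw, wordValue_lift_conjWord, lift_disjointCommutator, lift_disjointCommutator]
  rcases h (g 0) with h | h | h <;> simp [conj_pow, h]

end CombineLaws

/-! ### A law for `PSL₂(r)` -/

section PSLLaw

variable {r : ℕ} [Fact r.Prime]

theorem matrix_sq_eq {R : Type*} [CommRing R] (M : Matrix (Fin 2) (Fin 2) R) (hM : M.det = 1) :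
    M ^ 2 = M.trace • M - 1 := by
  rw [Matrix.det_fin_two] at hM
  ext i j
  fin_cases i <;> fin_cases j <;>
    simp [pow_two, Matrix.mul_apply, Fin.sum_univ_two, Matrix.trace]
  · linear_combination -hM
  · ring
  · ring
  · linear_combination -hM

theorem matrix_pow_eq {R : Type*} [CommRing R] (M : Matrix (Fin 2) (Fin 2) R) (hM : M.det = 1)
    (n : ℕ) : ∃ α β : R, M ^ n = α • 1 + β • M := by
  induction n with
  | zero => exact ⟨1, 0, by simp⟩
  | succ n ih =>
    obtain ⟨α, β, h⟩ := ih
    refine ⟨-β, α + β * M.trace, ?_⟩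
    rw [pow_succ, h, add_mul, smul_mul_assoc, smul_mul_assoc, ← pow_two, matrix_sq_eq M hM]
    simp only [one_mul, smul_sub, add_smul, mul_smul, neg_smul]
    abel

theorem det_smul_one_add_smul {R : Type*} [CommRing R] (M : Matrix (Fin 2) (Fin 2) R)
    (hM : M.det = 1) (α β : R) :
    (α • (1 : Matrix (Fin 2) (Fin 2) R) + β • M).det = α ^ 2 + α * β * M.trace + β ^ 2 := by
  rw [Matrix.det_fin_two] at hM ⊢
  simp [Matrix.trace, Fin.sum_univ_two]
  linear_combination β ^ 2 * hM

/-- Frobenius gives `(M - c) ^ r = M ^ r - c`, while the quadratic relation gives `(M - c) ^ r = (d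
- c) ^ (r - 1) • (M - c)`. The scalar is `0` or `1`, according to whether `c = d`. -/
theorem matrix_pow_card_eq (M : Matrix (Fin 2) (Fin 2) (ZMod r)) (c d : ZMod r)
    (h : (M - c • 1) * (M - d • 1) = 0) : M ^ r = M ∨ M ^ r = c • 1 := by
  have hfrob : (M - c • 1) ^ r = M ^ r - c • 1 := by
    rw [sub_pow_char_of_commute _ ((Commute.one_right M).smul_right c), smul_pow, one_pow,
      ZMod.pow_card]
  have hpow : ∀ n, (M - c • 1) ^ (n + 1) = (d - c) ^ n • (M - c • 1) := by
    intro n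
    induction n with
    | zero => simp
    | succ n ih =>
      have : (M - c • 1) * (M - c • 1) = (d - c) • (M - c • 1) := by
        have h' : (M - c • 1) * (M - c • 1) =
          (M - c • 1) * (M - d • 1) + (M - c • 1) * ((d - c) • 1) := by
          rw [← mul_add, sub_smul]; congr 1; abel
        rw [h', h, zero_add, mul_smul_comm, mul_one]
      rw [pow_succ, ih, smul_mul_assoc, this, smul_smul, ← pow_succ]
  have hr : 2 ≤ r := (Fact.out : r.Prime).two_le
  have h1 := hpow (r - 1)
  rw [show r - 1 + 1 = r by omega, hfrob] at h1
  by_cases hcd : d - c = 0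
  · right
    rwa [hcd, zero_pow (by omega), zero_smul, sub_eq_zero] at h1
  · left
    rwa [ZMod.pow_card_sub_one_eq_one hcd, one_smul, sub_left_inj] at h1

/-- The usual trichotomy: eigenvalues outside the prime field give order dividing `r + 1`, distinct
eigenvalues inside it give `r - 1`, and a repeated eigenvalue makes `A ^ r` scalar. The argument
stays over `ZMod r`, without passing to the quadratic extension. -/
theorem specialLinearGroup_pow_eq (A : Matrix.SpecialLinearGroup (Fin 2) (ZMod r)) :
    A ^ r ∈ Subgroup.center (Matrix.SpecialLinearGroup (Fin 2) (ZMod r)) ∨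
      A ^ (r - 1) = 1 ∨ A ^ (r + 1) = 1 := by
  have hr : 2 ≤ r := (Fact.out : r.Prime).two_le
  set M : Matrix (Fin 2) (Fin 2) (ZMod r) := A.1 with hMdef
  have hM : M.det = 1 := A.2
  have hinv : ∀ n : ℕ, M ^ n = 1 → A ^ n = 1 := fun n h => by
    apply Subtype.ext
    rw [Matrix.SpecialLinearGroup.coe_pow, h]
    rfl
  -- Frobenius fixes the trace `M + M⁻¹`
  set M' : Matrix (Fin 2) (Fin 2) (ZMod r) := (A⁻¹).1 with hM'def
  have hMM' : M * M' = 1 := congrArg Subtype.val (mul_inv_cancel A)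
  have hM'M : M' * M = 1 := congrArg Subtype.val (inv_mul_cancel A)
  have hsum : M + M' = M.trace • 1 := by
    have h1 : M * (M + M') = M * (M.trace • 1) := by
      rw [mul_add, hMM', ← pow_two, matrix_sq_eq M hM]; simp
    have h2 := congrArg (M' * ·) h1
    simpa only [← mul_assoc, hM'M, one_mul] using h2
  have hfrob : M ^ r + M' ^ r = M + M' := by
    rw [← add_pow_char_of_commute _ (show Commute M M' from hMM'.trans hM'M.symm), hsum, smul_pow,
      one_pow, ZMod.pow_card]
  have hcomm : Commute M M' := hMM'.trans hM'M.symm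
  -- Multiplying `M ^ r + M⁻¹ ^ r = M + M⁻¹` by `M ^ r` gives `M ^ (2r) + 1 = M ^ (r + 1) + M ^ (r -
  -- 1)`, which factors.
  have hprod : (M ^ (r - 1) - 1) * (M ^ (r + 1) - 1) = 0 := by
    have h1 : M ^ r * M' ^ r = 1 := by rw [← hcomm.mul_pow, hMM', one_pow]
    have h2 : M ^ r * (M ^ r + M' ^ r) = M ^ r * (M + M') := by rw [hfrob]
    have h3 : M ^ r = M ^ (r - 1) * M := by rw [← pow_succ]; congr 1; omega
    have h4 : M ^ r * M' = M ^ (r - 1) := by rw [h3, mul_assoc, hMM', mul_one]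
    rw [mul_add, mul_add, h1, h4, ← pow_add, ← pow_succ] at h2
    have h5 : r - 1 + (r + 1) = r + r := by omega
    rw [sub_mul, mul_sub, ← pow_add, h5, one_mul, mul_one, eq_sub_of_add_eq h2]
    abel
  obtain ⟨α, β, hαβ⟩ := matrix_pow_eq M hM (r - 1)
  by_cases hdet : IsUnit (M ^ (r - 1) - 1).det
  · right; right
    apply hinv
    have := (Matrix.isUnit_iff_isUnit_det _).mpr hdet
    rw [this.mul_right_eq_zero, sub_eq_zero] at hprod
    exact hprod
  rw [isUnit_iff_ne_zero, not_not] at hdet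
  have hX : M ^ (r - 1) - 1 = (α - 1) • 1 + β • M := by
    rw [hαβ, sub_smul, one_smul]; abel
  rw [hX, det_smul_one_add_smul M hM] at hdet
  by_cases hβ : β = 0
  · right; left
    apply hinv
    rw [hβ] at hdet hX
    have : α - 1 = 0 := by simpa using hdet
    rwa [this, zero_smul, zero_smul, zero_add, sub_eq_zero] at hX
  -- Singularity of `(α - 1) + β M` with `β ≠ 0` exhibits an eigenvalue of `M` in `ZMod r`; the
  -- other one is `c⁻¹`.
  let c : ZMod r := (1 - α) / β
  have hc : c ^ 2 - M.trace * c + 1 = 0 := by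
    simp only [c]
    field_simp
    linear_combination hdet
  have hc0 : c ≠ 0 := by
    intro h
    rw [h] at hc
    simp at hc
  have hfac : (M - c • 1) * (M - c⁻¹ • 1) = 0 := by
    have h1 : M.trace = c + c⁻¹ := by
      field_simp
      linear_combination -hc
    rw [sub_mul, mul_sub, mul_sub, ← pow_two, matrix_sq_eq M hM, h1]
    simp only [mul_smul_comm, mul_one, smul_mul_assoc, one_mul, add_smul, smul_smul,
      mul_comm c⁻¹ c, mul_inv_cancel₀ hc0, one_smul]
    abel
  rcases matrix_pow_card_eq M c c⁻¹ hfac with h | h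
  · right; left
    apply hinv
    have : M ^ (r - 1) * M = 1 * M := by
      rw [← pow_succ, one_mul, ← h]; congr 1; omega
    have h2 := congrArg (· * M') this
    simpa only [mul_assoc, hMM', mul_one] using h2
  · left
    rw [Matrix.SpecialLinearGroup.mem_center_iff]
    have hcoe : ((A ^ r : Matrix.SpecialLinearGroup (Fin 2) (ZMod r)) :
        Matrix (Fin 2) (Fin 2) (ZMod r)) = c • 1 := by
      rw [Matrix.SpecialLinearGroup.coe_pow]; exact h
    refine ⟨c, ?_, ?_⟩
    · have h1 := (A ^ r).2
      rw [hcoe, Matrix.det_smul, Matrix.det_one, mul_one] at h1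
      exact h1
    · rw [hcoe, Matrix.scalar_apply, Matrix.smul_one_eq_diagonal]

/-- A law for `PSL₂(r)` of length linear in `r`. -/
theorem exists_law_projectiveSpecialLinearGroup (r : ℕ) [Fact r.Prime] :
    ∃ v : FreeGroup (Fin 2), v ≠ 1 ∧ v.norm ≤ 36 * r ∧
      ∀ g : Fin 2 → Matrix.ProjectiveSpecialLinearGroup (Fin 2) (ZMod r), wordValue v g = 1 := by
  have hr : 2 ≤ r := (Fact.out : r.Prime).two_le
  refine ⟨powerLaw r (r - 1) (r + 1), powerLaw_ne_one (by omega) (by omega) (by omega),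
    (norm_powerLaw_le _ _ _).trans (by omega), wordValue_powerLaw fun x => ?_⟩
  induction x using QuotientGroup.induction_on with
  | H A =>
    simp only [← QuotientGroup.mk_pow]
    rcases specialLinearGroup_pow_eq A with h | h | h
    · exact Or.inl ((QuotientGroup.eq_one_iff _).mpr h)
    · exact Or.inr (Or.inl (by rw [h]; rfl))
    · exact Or.inr (Or.inr (by rw [h]; rfl))

end PSLLaw

/-! ### Words that are not laws for `PSL₂(r)` -/

section NotLaw

open Polynomial

variable (F : Type*) [Field F]

/-- Two matrices over `F[X]` with entries of degree at most one that generate a free group. -/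
noncomputable def polyGen : Fin 2 → Matrix.SpecialLinearGroup (Fin 2) F[X]
  | 0 => ⟨!![X, -1; 1, 0], by simp [Matrix.det_fin_two]⟩
  | 1 => ⟨!![C 2 * X + C 3, -X - C 2; C 2 * X + C 5, -X - C 3], by
      simp only [Matrix.det_fin_two_of, map_ofNat]; ring⟩

/-- The image of a letter of the free group under `polyGen`. -/
noncomputable def polyLetter (x : Fin 2 × Bool) : Matrix.SpecialLinearGroup (Fin 2) F[X] :=
  bif x.2 then polyGen F x.1 else (polyGen F x.1)⁻¹

/-- The column vector of the leading coefficient matrix of `polyLetter`, which has rank one. -/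
def leadCol : Fin 2 × Bool → Fin 2 → F
  | (0, true) => ![1, 0]
  | (0, false) => ![0, 1]
  | (1, true) => ![1, 1]
  | (1, false) => ![1, 2]

/-- The row vector of the leading coefficient matrix of `polyLetter`, which has rank one. -/
def leadRow : Fin 2 × Bool → Fin 2 → F
  | (0, true) => ![1, 0]
  | (0, false) => ![0, 1]
  | (1, true) => ![2, -1]
  | (1, false) => ![-1, 1]

variable {F}

theorem polyLetter_coe (x : Fin 2 × Bool) : (polyLetter F x).1 =
    match x with
    | (0, true) => !![X, -1; 1, 0]
    | (0, false) => !![0, 1; -1, X]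
    | (1, true) => !![C 2 * X + C 3, -X - C 2; C 2 * X + C 5, -X - C 3]
    | (1, false) => !![-X - C 3, X + C 2; -(C 2 * X + C 5), C 2 * X + C 3] := by
  have hinv : ∀ A : Matrix.SpecialLinearGroup (Fin 2) F[X], (A⁻¹).1 = A.1.adjugate := fun _ => rfl
  have h0 : (polyGen F 0).1 = !![X, -1; 1, 0] := rfl
  have h1 : (polyGen F 1).1 = !![C 2 * X + C 3, -X - C 2; C 2 * X + C 5, -X - C 3] := rfl
  match x with
  | (0, true) => exact h0
  | (0, false) =>
    refine (hinv _).trans ?_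
    rw [h0, Matrix.adjugate_fin_two_of, neg_neg]
  | (1, true) => exact h1
  | (1, false) =>
    refine (hinv _).trans ?_
    rw [h1, Matrix.adjugate_fin_two_of, neg_sub, sub_neg_eq_add, add_comm (C 2) X]

theorem natDegree_polyLetter_le (x : Fin 2 × Bool) (i j : Fin 2) :
    ((polyLetter F x).1 i j).natDegree ≤ 1 := by
  rw [polyLetter_coe]
  match x with
  | (0, true) | (0, false) | (1, true) | (1, false) =>
    fin_cases i <;> fin_cases j <;>
      simp only [Matrix.of_apply, Matrix.cons_val', Matrix.cons_val, Matrix.cons_val_fin_one,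
        Fin.zero_eta, Fin.mk_one] <;> compute_degree!

theorem coeff_polyLetter (x : Fin 2 × Bool) (i j : Fin 2) :
    ((polyLetter F x).1 i j).coeff 1 = leadCol F x i * leadRow F x j := by
  rw [polyLetter_coe]
  match x with
  | (0, true) | (0, false) | (1, true) | (1, false) =>
    fin_cases i <;> fin_cases j <;> simp [leadCol, leadRow, coeff_one, coeff_X, coeff_C]

/-- The row of `x` pairs to zero with the column of `y` only when `x` and `y` cancel, so leading
terms survive along a reduced word. -/
theorem leadRow_mul_leadCol_ne_zero (h2 : (2 : F) ≠ 0) (x y : Fin 2 × Bool)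
    (hxy : x.1 = y.1 → x.2 = y.2) :
    leadRow F x 0 * leadCol F y 0 + leadRow F x 1 * leadCol F y 1 ≠ 0 := by
  obtain ⟨a, b⟩ := x
  obtain ⟨a', b'⟩ := y
  fin_cases a <;> cases b <;> fin_cases a' <;> cases b' <;>
    simp [leadCol, leadRow, h2] at hxy ⊢ <;> norm_num

/-- A product of rank-one matrices `col * row` is its first column times its last row, scaled by the
successive pairings of row with next column. These are nonzero in a reduced word, so the degree is
exactly the length. -/
theorem coeff_prod_polyLetter (h2 : (2 : F) ≠ 0) (a : Fin 2 × Bool) (l : List (Fin 2 × Bool))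
    (hl : FreeGroup.IsReduced (a :: l)) :
    (∀ i j, ((((a :: l).map (polyLetter F)).prod).1 i j).natDegree ≤ l.length + 1) ∧
      ∃ c : F, c ≠ 0 ∧ ∃ y, ∀ i j,
        ((((a :: l).map (polyLetter F)).prod).1 i j).coeff (l.length + 1) =
          c * leadCol F a i * leadRow F y j := by
  induction l generalizing a with
  | nil =>
    simp only [List.map_cons, List.map_nil, List.prod_cons, List.prod_nil, mul_one,
      List.length_nil, zero_add]
    exact ⟨natDegree_polyLetter_le a, 1, one_ne_zero, a, fun i j => by
      rw [coeff_polyLetter, one_mul]⟩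
  | cons b l ih =>
    rw [FreeGroup.isReduced_cons_cons] at hl
    obtain ⟨hdeg, c, hc, y, hcoeff⟩ := ih b hl.2
    rw [List.map_cons, List.prod_cons]
    set P := ((b :: l).map (polyLetter F)).prod
    have hmul : ∀ i j, (polyLetter F a * P).1 i j =
        (polyLetter F a).1 i 0 * P.1 0 j + (polyLetter F a).1 i 1 * P.1 1 j := fun i j => by
      rw [Matrix.SpecialLinearGroup.coe_mul, Matrix.mul_apply, Fin.sum_univ_two]
    have hlen : (b :: l).length + 1 = 1 + (l.length + 1) := by simp [add_comm]
    refine ⟨fun i j => ?_, c * (leadRow F a 0 * leadCol F b 0 + leadRow F a 1 * leadCol F b 1),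
      mul_ne_zero hc (leadRow_mul_leadCol_ne_zero h2 a b hl.1), y, fun i j => ?_⟩
    · rw [hmul, hlen]
      exact natDegree_add_le_of_degree_le
        (natDegree_mul_le_of_le (natDegree_polyLetter_le _ _ _) (hdeg _ _))
        (natDegree_mul_le_of_le (natDegree_polyLetter_le _ _ _) (hdeg _ _))
    · rw [hmul, hlen, coeff_add,
        coeff_mul_add_eq_of_natDegree_le (natDegree_polyLetter_le _ _ _) (hdeg _ _),
        coeff_mul_add_eq_of_natDegree_le (natDegree_polyLetter_le _ _ _) (hdeg _ _), hcoeff, hcoeff,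
        coeff_polyLetter, coeff_polyLetter]
      ring

/-- A nontrivial word of length less than the odd prime `r` is not a law for `PSL₂(r)`. -/
theorem exists_wordValue_ne_one {r : ℕ} [Fact r.Prime] (hr : r ≠ 2) {w : FreeGroup (Fin 2)}
    (hw : w ≠ 1) (hwr : w.norm < r) :
    ∃ g : Fin 2 → Matrix.ProjectiveSpecialLinearGroup (Fin 2) (ZMod r), wordValue w g ≠ 1 := by
  by_contra! h
  have h2 : (2 : ZMod r) ≠ 0 := by
    intro h0
    have : ((2 : ℕ) : ZMod r) = 0 := by exact_mod_cast h0
    rw [ZMod.natCast_eq_zero_iff] at this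
    have := Nat.le_of_dvd (by norm_num) this
    have := (Fact.out : r.Prime).two_le
    omega
  set P := wordValue w (polyGen (ZMod r)) with hP
  -- If `w` is a law, then for each `t` the specialized value is central in `SL₂`, hence scalar.
  have hscalar : ∀ t : ZMod r, (P.1 0 1).eval t = 0 ∧ (P.1 1 0).eval t = 0 ∧
      (P.1 0 0 - P.1 1 1).eval t = 0 := by
    intro t
    have h1 := h fun i => QuotientGroup.mk' _
      (Matrix.SpecialLinearGroup.map (evalRingHom t) (polyGen (ZMod r) i))
    rw [← map_wordValue, ← map_wordValue, ← hP, QuotientGroup.mk'_apply, QuotientGroup.eq_one_iff,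
      Matrix.SpecialLinearGroup.mem_center_iff] at h1
    obtain ⟨c, -, hc⟩ := h1
    have hc' : ∀ i j, (P.1 i j).eval t = Matrix.scalar (Fin 2) c i j := fun i j => by
      rw [hc]; rfl
    simp [hc']
  have hdeg : ∃ n < r, (∀ i j, (P.1 i j).natDegree ≤ n) ∧ ∃ c : ZMod r, c ≠ 0 ∧ ∃ x y, ∀ i j,
      (P.1 i j).coeff n = c * leadCol (ZMod r) x i * leadRow (ZMod r) y j := by
    have hPl : P = (w.toWord.map (polyLetter (ZMod r))).prod := by
      rw [hP, wordValue]
      conv_lhs => rw [← FreeGroup.mk_toWord (x := w)]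
      rw [FreeGroup.lift_mk]
      rfl
    have hred : FreeGroup.IsReduced w.toWord := FreeGroup.isReduced_toWord
    have hne : w.toWord ≠ [] := by rwa [Ne, FreeGroup.toWord_eq_nil_iff]
    rw [FreeGroup.norm] at hwr
    rw [hPl]
    generalize w.toWord = l at hred hne hwr
    cases l with
    | nil => exact absurd rfl hne
    | cons a l =>
      obtain ⟨h1, c, hc, y, h3⟩ := coeff_prod_polyLetter h2 a l hred
      exact ⟨l.length + 1, by simpa using hwr, h1, c, hc, a, y, h3⟩
  obtain ⟨n, hn, hdeg, c, hc, x, y, hcoeff⟩ := hdeg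
  have hzero : ∀ p : (ZMod r)[X], p.natDegree ≤ n → (∀ t, p.eval t = 0) → p = 0 := fun p hp ht =>
    Polynomial.eq_zero_of_natDegree_lt_card_of_eval_eq_zero' p Finset.univ (fun t _ => ht t)
      (by rw [Finset.card_univ, ZMod.card]; omega)
  have e01 : P.1 0 1 = 0 := hzero _ (hdeg _ _) fun t => (hscalar t).1
  have e10 : P.1 1 0 = 0 := hzero _ (hdeg _ _) fun t => (hscalar t).2.1
  have e00 : P.1 0 0 - P.1 1 1 = 0 :=
    hzero _ ((natDegree_sub_le_of_le (hdeg _ _) (hdeg _ _)).trans (by simp))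
      fun t => (hscalar t).2.2
  have c01 := hcoeff 0 1
  have c10 := hcoeff 1 0
  have c00 := hcoeff 0 0
  rw [sub_eq_zero.mp e00, hcoeff 1 1] at c00
  rw [e01, coeff_zero] at c01
  rw [e10, coeff_zero] at c10
  -- These show that the column of `x` and the row of `y` are nonzero; a nonzero rank-one `2 × 2`
  -- matrix is not scalar.
  have hx := leadRow_mul_leadCol_ne_zero h2 x x fun _ => rfl
  have hy := leadRow_mul_leadCol_ne_zero h2 y y fun _ => rfl
  simp only [mul_assoc, zero_eq_mul, mul_eq_zero, hc, false_or, mul_eq_mul_left_iff, or_false] at c01 c10 c00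
  rcases c01 with h01 | h01 <;> rcases c10 with h10 | h10 <;> simp_all

end NotLaw

/-! ### Word length and complexity -/

section WordLength

variable {G : Type*} [Group G] {S : Set G}

theorem wordLength_le_of_list (l : List G) (hl : ∀ s ∈ l, s ∈ S ∨ s⁻¹ ∈ S) :
    wordLength S l.prod ≤ (l.length : ℕ∞) :=
  iInf₂_le l ⟨hl, rfl⟩

theorem exists_list_of_wordLength_le {g : G} {n : ℕ} (h : wordLength S g ≤ n) :
    ∃ l : List G, (∀ s ∈ l, s ∈ S ∨ s⁻¹ ∈ S) ∧ l.prod = g ∧ l.length ≤ n := by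
  have h1 : wordLength S g < ((n + 1 : ℕ) : ℕ∞) :=
    h.trans_lt (by exact_mod_cast Nat.lt_succ_self n)
  simp only [wordLength, iInf_lt_iff] at h1
  obtain ⟨l, ⟨hl, hg⟩, hn⟩ := h1
  exact ⟨l, hl, hg, Nat.lt_succ_iff.mp (by exact_mod_cast hn)⟩

theorem wordLength_one_le : wordLength S 1 ≤ 0 := by
  simpa using wordLength_le_of_list (S := S) [] (by simp)

theorem wordLength_le_one {g : G} (hg : g ∈ S) : wordLength S g ≤ 1 := by
  simpa using wordLength_le_of_list (S := S) [g] (by simp [hg])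

theorem wordLength_mul_le (x y : G) : wordLength S (x * y) ≤ wordLength S x + wordLength S y := by
  by_cases hx : wordLength S x = ⊤
  · simp [hx]
  by_cases hy : wordLength S y = ⊤
  · simp [hy]
  obtain ⟨m, hm⟩ := ENat.ne_top_iff_exists.mp hx
  obtain ⟨n, hn⟩ := ENat.ne_top_iff_exists.mp hy
  obtain ⟨l, hl, rfl, hlm⟩ := exists_list_of_wordLength_le hm.ge
  obtain ⟨l', hl', rfl, hln⟩ := exists_list_of_wordLength_le hn.ge
  rw [← hm, ← hn, ← List.prod_append]
  refine (wordLength_le_of_list (l ++ l') ?_).trans ?_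
  · intro s hs
    rcases List.mem_append.mp hs with hs | hs
    exacts [hl s hs, hl' s hs]
  · rw [List.length_append]
    exact_mod_cast add_le_add hlm hln

theorem wordLength_inv_le (x : G) : wordLength S x⁻¹ ≤ wordLength S x := by
  by_cases hx : wordLength S x = ⊤
  · simp [hx]
  obtain ⟨m, hm⟩ := ENat.ne_top_iff_exists.mp hx
  obtain ⟨l, hl, rfl, hlm⟩ := exists_list_of_wordLength_le hm.ge
  rw [← hm, List.prod_inv_reverse]
  refine (wordLength_le_of_list _ ?_).trans ?_
  · intro s hs
    simp only [List.mem_reverse, List.mem_map] at hs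
    obtain ⟨t, ht, rfl⟩ := hs
    simpa [or_comm] using hl t ht
  · simpa using hlm

theorem wordLength_pow_le (x : G) (n : ℕ) : wordLength S (x ^ n) ≤ n * wordLength S x := by
  induction n with
  | zero => simpa using wordLength_one_le
  | succ n ih =>
    rw [pow_succ]
    refine (wordLength_mul_le _ _).trans ?_
    push_cast
    rw [add_mul, one_mul]
    gcongr

theorem wordLength_conj_le (x y : G) :
    wordLength S (x * y * x⁻¹) ≤ 2 * wordLength S x + wordLength S y := by
  refine (wordLength_mul_le _ _).trans ((add_le_add (wordLength_mul_le _ _)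
    (wordLength_inv_le _)).trans_eq ?_)
  ring

theorem wordLength_commutator_le (x y : G) :
    wordLength S ⁅x, y⁆ ≤ 2 * (wordLength S x + wordLength S y) := by
  rw [commutatorElement_def]
  refine (wordLength_mul_le _ _).trans ((add_le_add (wordLength_conj_le _ _)
    (wordLength_inv_le _)).trans_eq ?_)
  ring

theorem one_le_wordLength {x : G} (hx : x ≠ 1) : 1 ≤ wordLength S x := by
  by_contra! h
  obtain ⟨l, -, rfl, h'⟩ := exists_list_of_wordLength_le (S := S) (g := x) (n := 0)
    (Order.lt_one_iff.mp h).le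
  rw [Nat.le_zero, List.length_eq_zero_iff] at h'
  exact hx (by rw [h', List.prod_nil])

theorem complexity_le {k : ℕ} {w : FreeGroup (Fin k)} {g : Fin k → G} (h : wordValue w g ≠ 1) :
    complexity S w ≤ ∑ i, wordLength S (g i) :=
  iInf₂_le g h

theorem complexity_le_complexity_map {k m : ℕ} {ι : Fin k → Fin m} (hι : Function.Injective ι)
    (w : FreeGroup (Fin k)) : complexity S w ≤ complexity S (FreeGroup.map ι w) := by
  refine le_iInf₂ fun g hg => ?_
  have h : wordValue (FreeGroup.map ι w) g = wordValue w (g ∘ ι) := by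
    rw [FreeGroup.map_eq_lift, wordValue_lift]
    congr 1
    ext i
    simp [wordValue]
  rw [h] at hg
  refine (complexity_le hg).trans ?_
  refine (Finset.sum_map Finset.univ ⟨ι, hι⟩ fun i => wordLength S (g i)).symm.trans_le ?_
  exact Finset.sum_le_sum_of_subset (Finset.subset_univ _)

theorem one_le_complexity_of {k : ℕ} (i : Fin k) : 1 ≤ complexity S (FreeGroup.of i) := by
  refine le_iInf₂ fun g hg => ?_
  have hg' : g i ≠ 1 := by simpa [wordValue] using hg
  exact (one_le_wordLength hg').trans
    (Finset.single_le_sum (f := fun i => wordLength S (g i)) (fun _ _ => zero_le) (Finset.mem_univ i))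

/-- Words of rank two built for the lower bound thereby serve for every `k ≥ 2`. -/
theorem complexity_le_lawlessnessGrowth {k m : ℕ} (hkm : k ≤ m) {w : FreeGroup (Fin k)}
    (hw : w ≠ 1) {l : ℕ+} (hl : w.norm ≤ l) : complexity S w ≤ lawlessnessGrowth S m l := by
  have hι := Fin.castLE_injective hkm
  refine (complexity_le_complexity_map hι w).trans
    (le_iSup₂_of_le (FreeGroup.map (Fin.castLE hkm) w) ⟨?_, (norm_map_le _ w).trans hl⟩ le_rfl)
  exact fun h => hw (FreeGroup.map_injective hι (h.trans (map_one _).symm))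

theorem one_le_lawlessnessGrowth {k : ℕ} (hk : 1 ≤ k) (l : ℕ+) :
    1 ≤ lawlessnessGrowth S k l :=
  (one_le_complexity_of (0 : Fin 1)).trans
    (complexity_le_lawlessnessGrowth hk (FreeGroup.of_ne_one _) (by
      rw [FreeGroup.norm_of]; exact l.pos))

theorem isLawless_of_complexity_ne_top
    (h : ∀ (k : ℕ) (w : FreeGroup (Fin k)), w ≠ 1 → complexity S w ≠ ⊤) : IsLawless G := by
  rintro k w ⟨hw, hlaw⟩
  refine h k w hw ?_
  simp [complexity, hlaw]

end WordLength

/-! ### The primes `pₙ` -/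

theorem sparsePrime_spec (l : ℕ+) :
    (sparsePrime l).Prime ∧ ((l : ℕ) : ℝ) < ((sparsePrime l : ℝ) - 1) / 3 := by
  refine Nat.sInf_mem (s := {r : ℕ | r.Prime ∧ ((l : ℕ) : ℝ) < ((r : ℝ) - 1) / 3}) ?_
  obtain ⟨r, hr, hprime⟩ := Nat.exists_infinite_primes (3 * l + 2)
  refine ⟨r, hprime, ?_⟩
  have : ((3 * l + 2 : ℕ) : ℝ) ≤ r := by exact_mod_cast hr
  push_cast at this
  linarith

/-- Bertrand's postulate gives a prime above `3 * l + 1` and at most `6 * l + 2 ≤ 8 * l`. -/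
theorem sparsePrime_le (l : ℕ+) : sparsePrime l ≤ 8 * l := by
  have hl : 1 ≤ (l : ℕ) := l.pos
  obtain ⟨r, hprime, hr, hr'⟩ := Nat.exists_prime_lt_and_le_two_mul (3 * l + 1) (by omega)
  have h : sparsePrime l ≤ r := by
    refine Nat.sInf_le (s := {r : ℕ | r.Prime ∧ ((l : ℕ) : ℝ) < ((r : ℝ) - 1) / 3}) ⟨hprime, ?_⟩
    have : ((3 * l + 1 : ℕ) : ℝ) < r := by exact_mod_cast hr
    push_cast at this
    linarith
  omega

instance (l : ℕ+) : Fact (sparsePrime l).Prime := ⟨(sparsePrime_spec l).1⟩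

theorem sparsePrime_ne_two (l : ℕ+) : sparsePrime l ≠ 2 := by
  intro h
  have h1 := (sparsePrime_spec l).2
  have h2 : (1 : ℝ) ≤ ((l : ℕ) : ℝ) := by exact_mod_cast l.pos
  rw [h] at h1
  norm_num at h1
  linarith

/-- Admissible elements exist. -/
theorem exists_isAdmissible (L : ℕ+ → ℕ+) : ∃ g h : ∀ n, LFactor L n, IsAdmissible L g h := by
  have key : ∀ (n : ℕ+) (w : ShortWord (sparsePrime (L n))),
      ∃ x : Fin 2 → Matrix.ProjectiveSpecialLinearGroup (Fin 2) (ZMod (sparsePrime (L n))),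
        wordValue w.1 x ≠ 1 := fun n w => by
    refine exists_wordValue_ne_one (sparsePrime_ne_two _) w.2.1 ?_
    have h1 := w.2.2
    have h2 : (1 : ℝ) ≤ sparsePrime (L n) := by
      exact_mod_cast (sparsePrime_spec (L n)).1.one_le
    have h3 : (w.1.norm : ℝ) < sparsePrime (L n) := by linarith
    exact_mod_cast h3
  choose x hx using key
  -- The factor has one copy of `PSL₂` per short word, so the coordinate indexed by `w` can be
  -- reserved for a pair on which `w` itself does not vanish.
  refine ⟨fun n w => x n w 0, fun n w => x n w 1, fun n w h => hx n w ?_⟩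
  have h1 := congrFun h w
  have h2 := map_wordValue (Pi.evalMonoidHom (fun _ : ShortWord (sparsePrime (L n)) =>
    Matrix.ProjectiveSpecialLinearGroup (Fin 2) (ZMod (sparsePrime (L n)))) w) w.1
    ![fun w => x n w 0, fun w => x n w 1]
  have h3 : x n w = fun i => Pi.evalMonoidHom (fun _ : ShortWord (sparsePrime (L n)) =>
      Matrix.ProjectiveSpecialLinearGroup (Fin 2) (ZMod (sparsePrime (L n)))) w
      ((![fun w => x n w 0, fun w => x n w 1] : Fin 2 → LFactor L n) i) := by
    ext i
    fin_cases i <;> rfl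
  rw [h3]
  exact h2.symm.trans h1

/-! ### The growth conditions -/

section Growth

variable {p q : ℕ+ → ℕ}

theorem GrowthConditions.strictMono_p (hpq : GrowthConditions p q) : StrictMono p :=
  strictMono_of_lt_add_one fun n _ => by have := hpq.p_succ n; omega

theorem GrowthConditions.strictMono_q (hpq : GrowthConditions p q) : StrictMono q :=
  strictMono_of_lt_add_one fun n _ => by
    have := hpq.q_succ n; omega

theorem GrowthConditions.p_le_q (hpq : GrowthConditions p q) (n : ℕ+) : p n ≤ q n := by
  induction n using PNat.recOn with
  | one => rw [hpq.p_one, hpq.q_one]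
  | succ n _ => have := hpq.q_succ n; omega

theorem GrowthConditions.monotone_sub (hpq : GrowthConditions p q) :
    Monotone fun n => q n - p n :=
  monotone_of_le_add_one fun n _ => by have := hpq.q_succ n; omega

theorem strictMono_of_growth {L : ℕ+ → ℕ+} (hL : ∀ n, 64 * L n + 29 ≤ L (n + 1)) :
    StrictMono L :=
  strictMono_of_lt_add_one fun n _ => by
    have h : 64 * (L n : ℕ) + 29 ≤ L (n + 1) := by exact_mod_cast hL n
    have : (L n : ℕ) < L (n + 1) := by omega
    exact_mod_cast this

end Growth

/-! ### Coordinates in the wreath product -/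

section Coordinates

variable {p q : ℕ+ → ℕ} {L : ℕ+ → ℕ+} {g h : ∀ n, LFactor L n}

theorem directSum.single_apply_self {ι : Type} (H : ι → Type) [∀ i, Group (H i)] (i : ι)
    (x : H i) : (directSum.single H i x).1 i = x := by
  classical
  exact Pi.mulSingle_eq_same i x

theorem directSum.single_apply_of_ne {ι : Type} (H : ι → Type) [∀ i, Group (H i)] {i j : ι}
    (hij : j ≠ i) (x : H i) : (directSum.single H i x).1 j = 1 := by
  classical
  exact Pi.mulSingle_eq_of_ne hij x

/-- The coordinate of a function `ℤ → Δ` at the integer `z` in the `n`-th summand of `Δ`. -/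
noncomputable def coord (L : ℕ+ → ℕ+) (z : ℤ) (n : ℕ+) : (ℤ → Base L) →* LFactor L n :=
  (Pi.evalMonoidHom _ n).comp ((directSum (LFactor L)).subtype.comp (Pi.evalMonoidHom _ z))

theorem coord_ext {φ ψ : ℤ → Base L} (h : ∀ z n, coord L z n φ = coord L z n ψ) : φ = ψ :=
  funext fun z => Subtype.ext (funext fun n => h z n)

theorem coord_spread_self {r : ℕ+ → ℕ} (hr : Function.Injective r) (x : ∀ n, LFactor L n)
    (n : ℕ+) : coord L (r n) n (spread L r x) = x n := by
  have hr' : Function.Injective fun n => (r n : ℤ) := Nat.cast_injective.comp hr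
  change (spread L r x (r n)).1 n = x n
  rw [spread, hr'.extend_apply (fun n => directSum.single (LFactor L) n (x n)) 1 n]
  exact directSum.single_apply_self _ n (x n)

theorem coord_spread_of_ne {r : ℕ+ → ℕ} (hr : Function.Injective r) (x : ∀ n, LFactor L n)
    {z : ℤ} {n : ℕ+} (hz : z ≠ r n) : coord L z n (spread L r x) = 1 := by
  have hr' : Function.Injective fun n => (r n : ℤ) := Nat.cast_injective.comp hr
  change (spread L r x z).1 n = 1
  by_cases hm : ∃ m, (r m : ℤ) = z
  · obtain ⟨m, rfl⟩ := hm
    rw [spread, hr'.extend_apply (fun n => directSum.single (LFactor L) n (x n)) 1 m]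
    exact directSum.single_apply_of_ne _
      (fun hnm => hz (congrArg (fun n => (r n : ℤ)) hnm.symm)) _
  · rw [spread, Function.extend_apply' _ _ _ hm]
    rfl

theorem coord_wordValue (z : ℤ) (n : ℕ+) (w : FreeGroup (Fin 2)) (φ ψ : ℤ → Base L) :
    coord L z n (wordValue w ![φ, ψ]) = wordValue w ![coord L z n φ, coord L z n ψ] := by
  rw [map_wordValue]
  congr 1
  ext i : 1
  fin_cases i <;> rfl

theorem wordValue_ofFun (w : FreeGroup (Fin 2)) (φ ψ : ℤ → Base L) :
    wordValue w ![ofFun φ, ofFun ψ] = ofFun (wordValue w ![φ, ψ]) := by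
  refine Eq.trans ?_ (map_wordValue (lamp (Base L)) w ![φ, ψ]).symm
  congr 1
  ext i : 1
  fin_cases i <;> rfl

theorem ofFun_ne_one {φ : ℤ → Base L} {z : ℤ} {n : ℕ+} (hφ : coord L z n φ ≠ 1) :
    ofFun φ ≠ 1 := fun h => by
  have h1 : φ = 1 := funext fun z => congrArg (fun x : Ambient L => x.left (.ofAdd z)) h
  exact hφ (by rw [h1, map_one])

end Coordinates

/-! ### Upper bound for the complexity -/

section UpperBound

variable {p q : ℕ+ → ℕ} {L : ℕ+ → ℕ+} {g h : ∀ n, LFactor L n}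

/-- One pair works for all words of length at most `L n` simultaneously. This lets it be substituted
into the images of words of any rank. -/
theorem exists_wordValue_ne_one_of_norm_le (hpq : GrowthConditions p q) (hadm : IsAdmissible L g h)
    (n : ℕ+) : ∃ a b : Gamma p q L g h, wordLength (generators p q L g h) a ≤ 1 ∧
      wordLength (generators p q L g h) b ≤ (2 * (q n - p n) + 1 : ℕ) ∧
      ∀ w : FreeGroup (Fin 2), w ≠ 1 → w.norm ≤ L n → wordValue w ![a, b] ≠ 1 := by
  set S := generators p q L g h
  have hmem : ∀ x : Ambient L, x ∈ ambientGenerators p q L g h →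
      ∃ y : Gamma p q L g h, y ∈ S ∧ y.1 = x := fun x hx =>
    ⟨⟨x, Subgroup.subset_closure hx⟩, hx, rfl⟩
  obtain ⟨a, ha, ha'⟩ := hmem (ofFun (spread L p g)) (by simp [ambientGenerators])
  obtain ⟨b, hb, hb'⟩ := hmem (ofFun (spread L q h)) (by simp [ambientGenerators])
  obtain ⟨t, ht, ht'⟩ := hmem (shift L) (by simp [ambientGenerators])
  set D := q n - p n with hD
  -- Conjugation by `t ^ (-D)` carries `h n` from position `q n` to position `p n`, where `g n`
  -- sits.
  refine ⟨a, (t ^ D)⁻¹ * b * (t ^ D)⁻¹⁻¹, wordLength_le_one ha, ?_, fun w hw hwn => ?_⟩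
  · refine (wordLength_conj_le _ _).trans ?_
    have h1 := (wordLength_inv_le (S := S) (t ^ D)).trans (wordLength_pow_le t D)
    calc 2 * wordLength S (t ^ D)⁻¹ + wordLength S b
        ≤ 2 * (D * 1) + 1 := by
          gcongr
          · exact h1.trans (by gcongr; exact wordLength_le_one ht)
          · exact wordLength_le_one hb
      _ = _ := by push_cast; ring
  · intro hcon
    have h1 : (Subgroup.closure (ambientGenerators p q L g h)).subtype (wordValue w ![a, (t ^ D)⁻¹ * b * (t ^ D)⁻¹⁻¹]) = 1 := by
      rw [hcon, map_one]
    have h2 : ((t ^ D)⁻¹ * b * (t ^ D)⁻¹⁻¹).1 = ofFun fun z => spread L q h (z + D) := by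
      have h3 := lamp_conj (-(D : ℤ)) (spread L q h)
      simp only [sub_neg_eq_add] at h3
      refine Eq.trans ?_ h3
      rw [zpow_neg, zpow_natCast]
      simp only [Subgroup.coe_mul, Subgroup.coe_inv, Subgroup.coe_pow, ht', hb']
      rfl
    rw [map_wordValue] at h1
    have h4 : (fun i => (Subgroup.closure (ambientGenerators p q L g h)).subtype
        ((![a, (t ^ D)⁻¹ * b * (t ^ D)⁻¹⁻¹] : Fin 2 → Gamma p q L g h) i)) =
        ![ofFun (spread L p g), ofFun fun z => spread L q h (z + D)] := by
      ext i : 1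
      fin_cases i
      exacts [ha', h2]
    rw [h4, wordValue_ofFun] at h1
    refine ofFun_ne_one (z := p n) (n := n) ?_ h1
    rw [coord_wordValue, coord_spread_self hpq.strictMono_p.injective]
    have h5 : coord L (p n) n (fun z => spread L q h (z + D)) = h n := by
      rw [← coord_spread_self hpq.strictMono_q.injective h n]
      have h6 : (p n : ℤ) + D = q n := by
        have := hpq.p_le_q n
        omega
      change (spread L q h (p n + D)).1 n = (spread L q h (q n)).1 n
      rw [h6]
    rw [h5]
    refine hadm n ⟨w, hw, lt_of_le_of_lt ?_ (sparsePrime_spec (L n)).2⟩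
    exact_mod_cast hwn

theorem exists_complexity_le (hpq : GrowthConditions p q) (hadm : IsAdmissible L g h) (k : ℕ) :
    ∃ c : ℕ+, ∀ w : FreeGroup (Fin k), w ≠ 1 → ∀ n, c * w.norm ≤ L n →
      complexity (generators p q L g h) w ≤ (c * (q n - p n + 1) : ℕ) := by
  -- With gap `D`, the `k` conjugates have total length at most `k * (2 * k * (2 * D + 1) + 1)`; the
  -- constant also dominates the factor `2 * k + 1` by which the embedding stretches words.
  refine ⟨⟨4 * k ^ 2 + 3 * k + 1, by positivity⟩, fun w hw n hwn => ?_⟩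
  obtain ⟨a, b, ha, hb, hab⟩ := exists_wordValue_ne_one_of_norm_le hpq hadm n
  set S := generators p q L g h
  have hj : Function.Injective fun i : Fin k => ((i : ℕ) : ℤ) :=
    Nat.cast_injective.comp Fin.val_injective
  set j : Fin k → ℤ := fun i => ((i : ℕ) : ℤ)
  have h1 : FreeGroup.lift (conjWord j) w ≠ 1 := by
    have := (lift_conjWord_injective j hj).ne hw
    rwa [map_one] at this
  have h2 : (FreeGroup.lift (conjWord j) w).norm ≤ L n := by
    refine (norm_lift_conjWord_le j k (fun i => ?_) w).trans (le_trans ?_ hwn)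
    · simp [j, i.2.le]
    · rw [PNat.mk_coe]
      gcongr
      nlinarith
  have h3 := hab _ h1 h2
  rw [wordValue_lift_conjWord] at h3
  refine (complexity_le (S := S) h3).trans ?_
  have h4 : ∀ i : Fin k, wordLength S (b ^ j i * a * (b ^ j i)⁻¹) ≤
      (2 * (k * (2 * (q n - p n) + 1)) + 1 : ℕ) := fun i => by
    refine (wordLength_conj_le _ _).trans ?_
    rw [show b ^ j i = b ^ (i : ℕ) from zpow_natCast _ _]
    have h5 := (wordLength_pow_le (S := S) b i).trans (mul_le_mul (a := ((i : ℕ) : ℕ∞)) (b := k)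
      (by exact_mod_cast i.2.le) hb zero_le zero_le)
    push_cast at h5 ⊢
    gcongr
  refine (Finset.sum_le_sum fun i _ => h4 i).trans ?_
  rw [Finset.sum_const, Finset.card_univ, Fintype.card_fin, nsmul_eq_mul]
  norm_cast
  rw [PNat.mk_coe]
  nlinarith [Nat.zero_le (k * (q n - p n)), Nat.zero_le (k * k * (q n - p n))]

theorem isLawless_gamma (hpq : GrowthConditions p q) (hL : ∀ n, 64 * L n + 29 ≤ L (n + 1))
    (hadm : IsAdmissible L g h) : IsLawless (Gamma p q L g h) := by
  refine isLawless_of_complexity_ne_top (S := generators p q L g h) fun k w hw => ?_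
  obtain ⟨c, hc⟩ := exists_complexity_le hpq hadm k
  -- `L` is strictly increasing, so `n ≤ L n`, and `n = c * w.norm + 1` is large enough.
  refine ne_top_of_le_ne_top (ENat.natCast_ne_top _)
    (hc w hw ⟨c * w.norm + 1, Nat.succ_pos _⟩ (le_trans (Nat.le_succ _) ?_))
  exact PNat.coe_le_coe _ _ |>.mpr
    ((strictMono_of_growth hL).le_apply (x := ⟨c * w.norm + 1, Nat.succ_pos _⟩))

end UpperBound

/-! ### Lower bound for the complexity -/

section LowerBound

variable {p q : ℕ+ → ℕ} {L : ℕ+ → ℕ+} {g h : ∀ n, LFactor L n}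

/-- The subgroup of the `n`-th summand of `Δ` generated by those of `g n`, `h n` that elements of
length `N` can move to the position `z`. -/
noncomputable def siteGroup (p q : ℕ+ → ℕ) (g h : ∀ n, LFactor L n) (N : ℕ) (z : ℤ) (n : ℕ+) :
    Subgroup (LFactor L n) :=
  Subgroup.closure ({x | x = g n ∧ |z - p n| ≤ N} ∪ {x | x = h n ∧ |z - q n| ≤ N})

theorem siteGroup_mono {N N' : ℕ} {s z : ℤ} (hs : |s| + N ≤ N') (n : ℕ+) :
    siteGroup p q g h N (z - s) n ≤ siteGroup p q g h N' z n := by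
  refine Subgroup.closure_mono (Set.union_subset_union ?_ ?_) <;>
  · rintro x ⟨hx, hz⟩
    refine ⟨hx, ?_⟩
    rw [abs_le] at *
    have := abs_le.mp (le_refl |s|)
    constructor <;> linarith

/-- No position is within `N` of both `p n` and `q n`, so at most one of `g n`, `h n` generates the
group. -/
theorem siteGroup_comm {N : ℕ} {z : ℤ} {n : ℕ+} (hN : 2 * N < q n - p n) {x y : LFactor L n}
    (hx : x ∈ siteGroup p q g h N z n) (hy : y ∈ siteGroup p q g h N z n) : Commute x y := by
  have hcomm : ∀ x ∈ ({x | x = g n ∧ |z - p n| ≤ N} ∪ {x | x = h n ∧ |z - q n| ≤ N} :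
      Set (LFactor L n)), ∀ y ∈ ({x | x = g n ∧ |z - p n| ≤ N} ∪ {x | x = h n ∧ |z - q n| ≤ N} :
      Set (LFactor L n)), x * y = y * x := by
    have hfar : |z - p n| ≤ N → |z - q n| ≤ N → False := fun h1 h2 => by
      rw [abs_le] at h1 h2
      omega
    rintro x (⟨rfl, h1⟩ | ⟨rfl, h1⟩) y (⟨rfl, h2⟩ | ⟨rfl, h2⟩)
    exacts [rfl, (hfar h1 h2).elim, (hfar h2 h1).elim, rfl]
  have := Subgroup.isMulCommutative_closure hcomm
  exact congrArg Subtype.val (mul_comm' (⟨x, hx⟩ : Subgroup.closure _) ⟨y, hy⟩)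

/-- The restrictions on the coordinates of elements of length at most `N`. -/
def Controlled (p q : ℕ+ → ℕ) (g h : ∀ n, LFactor L n) (N : ℕ) (x : Ambient L) : Prop :=
  |x.right.toAdd| ≤ N ∧
    ∀ z n, coord L z n (fun z => x.left (.ofAdd z)) ∈ siteGroup p q g h N z n

/-- In the product, the coordinate of `y` is read at a position translated by the shift of `x`,
which is at most `M`; enlarging the radius from `N` to `M + N` absorbs this. -/
theorem Controlled.mul {M N : ℕ} {x y : Ambient L} (hx : Controlled p q g h M x)
    (hy : Controlled p q g h N y) : Controlled p q g h (M + N) (x * y) := by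
  refine ⟨?_, fun z n => ?_⟩
  · have h1 := abs_add_le x.right.toAdd y.right.toAdd
    have h2 := hx.1
    have h3 := hy.1
    rw [RegularWreathProduct.mul_right, toAdd_mul]
    push_cast
    linarith
  · have h1 : coord L z n (fun z => (x * y).left (.ofAdd z)) =
        coord L z n (fun z => x.left (.ofAdd z)) *
          coord L (z - x.right.toAdd) n (fun z => y.left (.ofAdd z)) := by
      rw [sub_eq_neg_add]
      rfl
    rw [h1]
    refine mul_mem ?_ ?_
    · have := siteGroup_mono (p := p) (q := q) (g := g) (h := h) (N := M) (N' := M + N) (s := 0)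
        (z := z) (by simp) n
      rw [sub_zero] at this
      exact this (hx.2 z n)
    · refine siteGroup_mono ?_ n (hy.2 _ n)
      have := hx.1
      push_cast
      linarith

theorem controlled_one : Controlled p q g h 0 1 :=
  ⟨by simp, fun z n => by
    have : coord L z n (fun z => (1 : Ambient L).left (.ofAdd z)) = 1 := rfl
    rw [this]; exact one_mem _⟩

theorem controlled_ofFun (N : ℕ) {φ : ℤ → Base L}
    (hφ : ∀ z n, coord L z n φ ∈ siteGroup p q g h N z n) : Controlled p q g h N (ofFun φ) :=
  ⟨by simp [ofFun], hφ⟩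

theorem controlled_generator (hpq : GrowthConditions p q) {x : Ambient L}
    (hx : x ∈ ambientGenerators p q L g h ∨ x⁻¹ ∈ ambientGenerators p q L g h) :
    Controlled p q g h 1 x := by
  have hsub : ∀ (n : ℕ+) (z : ℤ), z = p n → g n ∈ siteGroup p q g h 1 z n := fun n z hz =>
    Subgroup.subset_closure (Or.inl ⟨rfl, by simp [hz]⟩)
  have hsub' : ∀ (n : ℕ+) (z : ℤ), z = q n → h n ∈ siteGroup p q g h 1 z n := fun n z hz =>
    Subgroup.subset_closure (Or.inr ⟨rfl, by simp [hz]⟩)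
  have hg : ∀ z n, coord L z n (spread L p g) ∈ siteGroup p q g h 1 z n := fun z n => by
    by_cases hz : z = p n
    · rw [hz, coord_spread_self hpq.strictMono_p.injective]
      exact hsub n _ rfl
    · rw [coord_spread_of_ne hpq.strictMono_p.injective g hz]
      exact one_mem _
  have hh : ∀ z n, coord L z n (spread L q h) ∈ siteGroup p q g h 1 z n := fun z n => by
    by_cases hz : z = q n
    · rw [hz, coord_spread_self hpq.strictMono_q.injective]
      exact hsub' n _ rfl
    · rw [coord_spread_of_ne hpq.strictMono_q.injective h hz]
      exact one_mem _
  have hinv : ∀ φ : ℤ → Base L, (ofFun φ : Ambient L)⁻¹ = ofFun φ⁻¹ := fun φ =>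
    (map_inv (lamp (Base L)) φ).symm
  rcases hx with hx | hx
  · rcases hx with rfl | rfl | rfl
    · exact controlled_ofFun 1 hg
    · exact controlled_ofFun 1 hh
    · refine ⟨by simp [shift], fun z n => ?_⟩
      exact one_mem _
  · rw [← inv_inv x]
    rcases hx with hx | hx | hx <;> rw [hx]
    · rw [hinv]
      exact controlled_ofFun 1 fun z n => by rw [map_inv]; exact inv_mem (hg z n)
    · rw [hinv]
      exact controlled_ofFun 1 fun z n => by rw [map_inv]; exact inv_mem (hh z n)
    · refine ⟨by simp [shift], fun z n => ?_⟩
      have : coord L z n (fun z => (shift L)⁻¹.left (.ofAdd z)) = 1 := by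
        change (1 : LFactor L n)⁻¹ = 1
        exact inv_one
      rw [this]; exact one_mem _

theorem Controlled.mono {M N : ℕ} (hMN : M ≤ N) {x : Ambient L} (hx : Controlled p q g h M x) :
    Controlled p q g h N x :=
  ⟨hx.1.trans (by exact_mod_cast hMN), fun z n => by
    have := siteGroup_mono (p := p) (q := q) (g := g) (h := h) (N := M) (N' := N) (s := 0)
      (z := z) (by simpa using hMN) n
    rw [sub_zero] at this
    exact this (hx.2 z n)⟩

theorem controlled_of_wordLength_le (hpq : GrowthConditions p q) {x : Gamma p q L g h} {N : ℕ}
    (hx : wordLength (generators p q L g h) x ≤ N) : Controlled p q g h N x := by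
  obtain ⟨l, hl, rfl, hN⟩ := exists_list_of_wordLength_le hx
  refine Controlled.mono hN ?_
  clear hx hN
  induction l with
  | nil => exact controlled_one
  | cons s l ih =>
    rw [List.prod_cons, List.length_cons, add_comm]
    exact (controlled_generator hpq (hl s (by simp))).mul (ih fun s hs => hl s (by simp [hs]))

/-- The commutators `[x, y]` and `[x, y²]` in the free group on `x, y`. -/
def commWord : Fin 2 → FreeGroup (Fin 2) :=
  ![⁅FreeGroup.of (0 : Fin 2), FreeGroup.of (1 : Fin 2)⁆,
    ⁅FreeGroup.of (0 : Fin 2), FreeGroup.of (1 : Fin 2) ^ 2⁆]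

theorem norm_commWord_le (i : Fin 2) : (commWord i).norm ≤ 6 := by
  have h1 := norm_commutator_le (FreeGroup.of (0 : Fin 2)) (FreeGroup.of 1)
  have h2 := norm_commutator_le (FreeGroup.of (0 : Fin 2)) (FreeGroup.of 1 ^ 2)
  simp only [FreeGroup.norm_of, FreeGroup.norm_of_pow] at h1 h2
  fin_cases i
  exacts [h1.trans (by norm_num : 2 * (1 + 1) ≤ 6), h2]

/-- With `xᵢ = y ^ i * x * y ^ (-i)` free, the two commutators are `x₀ x₁⁻¹` and `x₀ x₂⁻¹`; sending
`x₀` to `1` recovers two free generators. -/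
theorem lift_commWord_injective : Function.Injective (FreeGroup.lift commWord) := by
  let j : Fin 3 → ℤ := ![0, 1, 2]
  have hj : Function.Injective j := by decide
  let s : Fin 2 → FreeGroup (Fin 3) :=
    ![FreeGroup.of 0 * (FreeGroup.of 1)⁻¹, FreeGroup.of 0 * (FreeGroup.of 2)⁻¹]
  have h1 : FreeGroup.lift commWord = (FreeGroup.lift (conjWord j)).comp (FreeGroup.lift s) := by
    ext i : 1
    fin_cases i
    · simp [commWord, s, j, conjWord, commutatorElement_def, mul_assoc]
    · simp [commWord, s, j, conjWord, commutatorElement_def, mul_assoc]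
  have h2 : Function.LeftInverse
      (FreeGroup.lift (![1, (FreeGroup.of 0)⁻¹, (FreeGroup.of 1)⁻¹] : Fin 3 → FreeGroup (Fin 2)))
      (FreeGroup.lift s) := by
    intro w
    have : (FreeGroup.lift (![1, (FreeGroup.of 0)⁻¹, (FreeGroup.of 1)⁻¹] :
        Fin 3 → FreeGroup (Fin 2))).comp (FreeGroup.lift s) = MonoidHom.id _ := by
      ext i : 1
      fin_cases i <;> simp [s]
    exact DFunLike.congr_fun this w
  rw [h1, MonoidHom.coe_comp]
  exact (lift_conjWord_injective j hj).comp h2.injective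

/-- Words that are laws for the first `m` summands of `Δ` and for commuting pairs, of length
linear in `L m`. -/
theorem exists_common_law (hL : ∀ n, 64 * L n + 29 ≤ L (n + 1)) (m : ℕ+) :
    ∃ v : FreeGroup (Fin 2), v ≠ 1 ∧ v.norm ≤ 5760 * L m ∧
      (∀ n ≤ m, ∀ x : Fin 2 → LFactor L n, wordValue v x = 1) ∧
      ∀ (G : Type) [Group G] (x : Fin 2 → G), Commute (x 0) (x 1) → wordValue v x = 1 := by
  have key : ∀ n, ∃ v : FreeGroup (Fin 2), v ≠ 1 ∧ v.norm ≤ 288 * L n ∧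
      ∀ x : Fin 2 → LFactor L n, wordValue v x = 1 := fun n => by
    obtain ⟨v, hv, hvn, hlaw⟩ := exists_law_projectiveSpecialLinearGroup (sparsePrime (L n))
    have := sparsePrime_le (L n)
    refine ⟨v, hv, by omega, fun x => funext fun w => ?_⟩
    exact (map_wordValue (Pi.evalMonoidHom (fun _ : ShortWord (sparsePrime (L n)) =>
      Matrix.ProjectiveSpecialLinearGroup (Fin 2) (ZMod (sparsePrime (L n)))) w) v x).trans
      (hlaw _)
  induction m using PNat.recOn with
  | one =>
    obtain ⟨v, hv, hvn, hlaw⟩ := key 1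
    -- Even one law is combined with itself, since the commutator form is what kills commuting
    -- pairs.
    refine ⟨combine v v, combine_ne_one hv hv, (norm_combine_le v v).trans (by omega),
      fun n hn x => ?_, fun G _ x hx => wordValue_combine_of_commute v v x hx⟩
    obtain rfl : n = 1 := le_antisymm hn (one_le)
    exact wordValue_combine_of_left hlaw v x
  | succ m ih =>
    obtain ⟨u, hu, hun, hulaw, -⟩ := ih
    obtain ⟨v, hv, hvn, hlaw⟩ := key (m + 1)
    have hLm : 64 * (L m : ℕ) + 29 ≤ L (m + 1) := by exact_mod_cast hL m
    -- The length stays linear because `10 * (5760 / 64 + 288) = 3780 ≤ 5760`.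
    refine ⟨combine u v, combine_ne_one hu hv, (norm_combine_le u v).trans (by omega),
      fun n hn x => ?_, fun G _ x hx => wordValue_combine_of_commute u v x hx⟩
    rcases hn.lt_or_eq with hn | rfl
    · exact wordValue_combine_of_left (hulaw n (PNat.lt_add_one_iff.mp hn)) v x
    · exact wordValue_combine_of_right u hlaw x

/-- The quotient `ℤ` is abelian, so commutators have no shift and can be evaluated coordinate by
coordinate. -/
theorem commutator_eq_ofFun (x y : Ambient L) :
    ⁅x, y⁆ = ofFun fun z => ⁅x, y⁆.left (.ofAdd z) := by
  ext z
  · rfl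
  · have : RegularWreathProduct.rightHom ⁅x, y⁆ = 1 := by
      rw [map_commutatorElement, commutatorElement_eq_one_iff_mul_comm, mul_comm]
    exact this

/-- In summands up to `m` the word is a law; beyond, the gap is at least the one at `m + 1`, so the
coordinates of the two arguments commute. -/
theorem wordValue_eq_one_of_controlled {m : ℕ+} {v : FreeGroup (Fin 2)}
    (hpq : GrowthConditions p q)
    (hlaw : ∀ n ≤ m, ∀ x : Fin 2 → LFactor L n, wordValue v x = 1)
    (hcomm : ∀ (G : Type) [Group G] (x : Fin 2 → G), Commute (x 0) (x 1) → wordValue v x = 1)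
    {N : ℕ} (hN : 2 * N < q (m + 1) - p (m + 1)) {φ ψ : ℤ → Base L}
    (hφ : Controlled p q g h N (ofFun φ)) (hψ : Controlled p q g h N (ofFun ψ)) :
    wordValue v ![ofFun φ, ofFun ψ] = 1 := by
  rw [wordValue_ofFun]
  have : wordValue v ![φ, ψ] = 1 := by
    refine coord_ext fun z n => ?_
    rw [coord_wordValue, map_one]
    rcases le_or_gt n m with hn | hn
    · exact hlaw n hn _
    · have h1 := hpq.monotone_sub (PNat.add_one_le_iff.mpr hn)
      exact hcomm _ _ (siteGroup_comm (hN.trans_le h1) (hφ.2 z n) (hψ.2 z n))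
  rw [this]
  rfl

/-- The factor `8` arises because inputs of total length `c` give commutators of length at most `4 *
c`, and triviality needs twice that to be below the gap. The length constant is `6 * 5760`. -/
theorem exists_le_complexity (hpq : GrowthConditions p q) (hL : ∀ n, 64 * L n + 29 ≤ L (n + 1))
    (m : ℕ+) : ∃ w : FreeGroup (Fin 2), w ≠ 1 ∧ w.norm ≤ 34560 * L m ∧
      ((q (m + 1) - p (m + 1) : ℕ) : ℕ∞) ≤ 8 * complexity (generators p q L g h) w := by
  obtain ⟨v, hv, hvn, hlaw, hcomm⟩ := exists_common_law hL m
  refine ⟨FreeGroup.lift commWord v, ?_, ?_, ?_⟩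
  · have := lift_commWord_injective.ne hv
    rwa [map_one] at this
  · exact (norm_lift_le _ 6 norm_commWord_le v).trans (by omega)
  set S := generators p q L g h
  by_contra! hcon
  have h1 : complexity S (FreeGroup.lift commWord v) < ⊤ := by
    refine lt_top_iff_ne_top.mpr fun htop => ?_
    rw [htop] at hcon
    simp at hcon
  obtain ⟨c, hc⟩ := ENat.ne_top_iff_exists.mp h1.ne
  have h2 : complexity S (FreeGroup.lift commWord v) < ((c + 1 : ℕ) : ℕ∞) := by
    rw [← hc]; exact_mod_cast Nat.lt_succ_self c
  simp only [complexity, iInf_lt_iff] at h2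
  obtain ⟨x, hx, hlt⟩ := h2
  rw [Fin.sum_univ_two] at hlt
  have hle : wordLength S (x 0) + wordLength S (x 1) ≤ c :=
    ENat.lt_natCast_add_one_iff.mp (by exact_mod_cast hlt)
  have h3 : wordLength S ⁅x 0, x 1⁆ ≤ (4 * c : ℕ) := by
    refine (wordLength_commutator_le _ _).trans ?_
    calc 2 * (wordLength S (x 0) + wordLength S (x 1)) ≤ 4 * c := by gcongr; norm_num
      _ = _ := by push_cast; rfl
  have h4 : wordLength S ⁅x 0, x 1 ^ 2⁆ ≤ (4 * c : ℕ) := by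
    refine (wordLength_commutator_le _ _).trans ?_
    calc 2 * (wordLength S (x 0) + wordLength S (x 1 ^ 2))
        ≤ 2 * (2 * wordLength S (x 0) + 2 * wordLength S (x 1)) := by
          gcongr
          · exact le_mul_of_one_le_left zero_le (by norm_num)
          · exact wordLength_pow_le _ 2
      _ = 4 * (wordLength S (x 0) + wordLength S (x 1)) := by ring
      _ ≤ 4 * c := by gcongr
      _ = _ := by push_cast; rfl
  have h5 := controlled_of_wordLength_le hpq h3
  have h6 := controlled_of_wordLength_le hpq h4
  have e1 : ((⁅x 0, x 1⁆ : Gamma p q L g h) : Ambient L) = ⁅(x 0).1, (x 1).1⁆ := rfl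
  have e2 : ((⁅x 0, x 1 ^ 2⁆ : Gamma p q L g h) : Ambient L) = ⁅(x 0).1, (x 1).1 ^ 2⁆ := rfl
  rw [e1, commutator_eq_ofFun] at h5
  rw [e2, commutator_eq_ofFun] at h6
  have hN : 2 * (4 * c) < q (m + 1) - p (m + 1) := by
    have : (8 * c : ℕ∞) < (q (m + 1) - p (m + 1) : ℕ) := by rw [hc]; exact hcon
    have h7 : 8 * c < q (m + 1) - p (m + 1) := by exact_mod_cast this
    omega
  have h8 := wordValue_eq_one_of_controlled hpq hlaw hcomm hN h5 h6
  rw [← commutator_eq_ofFun, ← commutator_eq_ofFun] at h8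
  refine hx (Subtype.ext (Eq.trans ?_ h8))
  rw [wordValue_lift]
  refine (map_wordValue (Subgroup.closure (ambientGenerators p q L g h)).subtype v _).trans ?_
  congr 1
  ext i : 1
  fin_cases i
  · simp [commWord, wordValue, map_commutatorElement]
  · simp [commWord, wordValue, map_commutatorElement]

end LowerBound

/-! ### Elementary amenability -/

section ElementaryAmenable

/-- A group all of whose finitely generated subgroups are elementary amenable is elementary
amenable. -/
theorem IsElementaryAmenable.of_closure_finset {G : Type} [Group G]
    (h : ∀ s : Finset G, IsElementaryAmenable (Subgroup.closure (s : Set G))) :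
    IsElementaryAmenable G := by
  classical
  let F : ∀ s t : Finset G, s ≤ t →
      Subgroup.closure (s : Set G) →* Subgroup.closure (t : Set G) := fun s t hst =>
    Subgroup.inclusion (Subgroup.closure_mono (Finset.coe_subset.mpr hst))
  have : DirectedSystem (fun s : Finset G => Subgroup.closure (s : Set G))
      (fun i j h => F i j h) :=
    { map_self := fun _ _ => rfl
      map_map := fun _ _ _ _ _ _ => rfl }
  let φ : DirectLimit (fun s : Finset G => Subgroup.closure (s : Set G)) F →* G :=
    { toFun := DirectLimit.lift F (fun s => (Subgroup.closure (s : Set G)).subtype)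
        fun _ _ _ _ => rfl
      map_one' := DirectLimit.lift_one (f := F)
        (fun s => (Subgroup.closure (s : Set G)).subtype) fun _ _ _ _ => rfl
      map_mul' := DirectLimit.lift_mul (f := F)
        (fun s => (Subgroup.closure (s : Set G)).subtype) fun _ _ _ _ => rfl }
  refine of_surjective φ (fun x => ⟨⟦⟨{x}, ⟨x, Subgroup.subset_closure (by simp)⟩⟩⟧, rfl⟩)
    (directLimit _ F h)

theorem IsElementaryAmenable.of_ker {G H : Type} [Group G] [Group H] (φ : G →* H)
    (hK : IsElementaryAmenable φ.ker) (hH : IsElementaryAmenable H) : IsElementaryAmenable G :=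
  extension φ.ker hK (of_injective (QuotientGroup.kerLift φ) (QuotientGroup.kerLift_injective φ) hH)

theorem IsElementaryAmenable.of_comm {G : Type} [Group G] (hG : ∀ x y : G, x * y = y * x) :
    IsElementaryAmenable G := by
  classical
  refine of_closure_finset fun s => ?_
  induction s using Finset.induction_on with
  | empty =>
    rw [Finset.coe_empty, Subgroup.closure_empty]
    exact of_finite _
  | insert a s _ ih =>
    set H := Subgroup.closure ((insert a s : Finset G) : Set G) with hH
    have hsH : Subgroup.closure (s : Set G) ≤ H := Subgroup.closure_mono (by simp)
    let N := (Subgroup.closure (s : Set G)).subgroupOf H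
    have hN : N.Normal := ⟨fun n hn g => by
      rwa [show g * n * g⁻¹ = n by
        rw [show g * n = n * g from Subtype.ext (hG _ _), mul_inv_cancel_right]]⟩
    refine extension N (of_injective (Subgroup.subgroupOfEquivOfLe hsH).toMonoidHom
      (Subgroup.subgroupOfEquivOfLe hsH).injective ih) ?_
    have haH : a ∈ H := Subgroup.subset_closure (by simp)
    -- The quotient of `H` by the subgroup of the earlier generators is cyclic, generated by the
    -- image of `a`.
    let ψ : Multiplicative ℤ →* H ⧸ N :=
      zpowersHom (H ⧸ N) (QuotientGroup.mk' N ⟨a, haH⟩)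
    refine of_surjective ψ ?_ int
    have hrange : ψ.range.comap (QuotientGroup.mk' N) = ⊤ := by
      rw [eq_top_iff, ← Subgroup.closure_closure_coe_preimage, Subgroup.closure_le]
      rintro ⟨x, hx⟩ hx'
      simp only [Set.mem_preimage, Finset.coe_insert, Set.mem_insert_iff, Finset.mem_coe] at hx'
      rcases hx' with rfl | hx'
      · exact ⟨.ofAdd 1, by simp [ψ]⟩
      · refine ⟨1, ?_⟩
        rw [map_one, eq_comm, QuotientGroup.mk'_apply, QuotientGroup.eq_one_iff]
        exact Subgroup.subset_closure hx'
    intro y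
    obtain ⟨x, rfl⟩ := QuotientGroup.mk'_surjective N y
    exact hrange.ge (Subgroup.mem_top x)

/-- A group that embeds in a direct sum of finite groups is elementary amenable. -/
theorem IsElementaryAmenable.of_finite_support {G ι : Type} [Group G] {H : ι → Type}
    [∀ i, Group (H i)] [∀ i, Finite (H i)] (e : ∀ i, G →* H i)
    (he : ∀ x, (∀ i, e i x = 1) → x = 1) (hfin : ∀ x, {i | e i x ≠ 1}.Finite) :
    IsElementaryAmenable G := by
  refine of_closure_finset fun s => ?_
  have hF : (⋃ x ∈ s, {i | e i x ≠ 1}).Finite := s.finite_toSet.biUnion fun x _ => hfin x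
  set F := ⋃ x ∈ s, {i | e i x ≠ 1}
  have : Finite F := hF
  have hsupp : ∀ i ∉ F, ∀ x ∈ Subgroup.closure (s : Set G), e i x = 1 := by
    intro i hi x hx
    have : Subgroup.closure (s : Set G) ≤ (e i).ker := by
      rw [Subgroup.closure_le]
      intro y hy
      by_contra h
      exact hi (Set.mem_biUnion hy h)
    exact this hx
  refine of_injective (G := ∀ i : F, H i)
    ((MonoidHom.pi fun i : F => e i).comp (Subgroup.subtype _)) ?_ (of_finite _)
  rw [injective_iff_map_eq_one]
  intro x hx
  refine Subtype.ext (he _ fun i => ?_)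
  by_cases hi : i ∈ F
  · exact congrFun hx ⟨i, hi⟩
  · exact hsupp i hi x x.2

/-- The elements supported in finitely many summands `i` form a normal subgroup. It embeds in a
direct sum of finite groups by `hfin`, and `hcomm` makes the quotient abelian. -/
theorem isElementaryAmenable_of_coordinates {G ι κ : Type} [Group G] {H : ι → Type}
    [∀ i, Group (H i)] [∀ i, Finite (H i)] (e : ∀ i, κ → G →* H i)
    (he : ∀ x, (∀ i z, e i z x = 1) → x = 1) (hfin : ∀ x i, {z | e i z x ≠ 1}.Finite)
    (hcomm : ∀ x y : G, {i | ∃ z, e i z ⁅x, y⁆ ≠ 1}.Finite) : IsElementaryAmenable G := by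
  let N : Subgroup G :=
    { carrier := {x | {i | ∃ z, e i z x ≠ 1}.Finite}
      one_mem' := by simp
      mul_mem' := by
        intro x y hx hy
        refine (Set.Finite.union hx hy).subset ?_
        rintro i ⟨z, hz⟩
        by_contra h
        simp only [Set.mem_union, Set.mem_ofPred_eq, not_or, not_exists, not_not] at h
        exact hz (by rw [map_mul, h.1, h.2, one_mul])
      inv_mem' := by
        intro x hx
        simpa using hx }
  have hN : N.Normal := ⟨fun x hx g => by
    refine Set.Finite.subset hx ?_
    rintro i ⟨z, hz⟩
    refine ⟨z, fun h => hz ?_⟩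
    rw [map_mul, map_mul, h, mul_one, ← map_mul, mul_inv_cancel, map_one]⟩
  refine .extension N ?_ (.of_comm ?_)
  · refine .of_finite_support (ι := ι × κ) (H := fun i => H i.1)
      (fun i => (e i.1 i.2).comp N.subtype)
      (fun x hx => Subtype.ext (he _ fun i z => hx (i, z))) fun x => ?_
    refine (Set.Finite.biUnion x.2 fun i _ => (hfin x i).image fun z => (i, z)).subset ?_
    rintro ⟨i, z⟩ hz
    exact Set.mem_biUnion (show i ∈ {i | ∃ z, e i z x ≠ 1} from ⟨z, hz⟩) ⟨z, hz, rfl⟩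
  · intro x y
    obtain ⟨x, rfl⟩ := QuotientGroup.mk'_surjective N x
    obtain ⟨y, rfl⟩ := QuotientGroup.mk'_surjective N y
    rw [← commutatorElement_eq_one_iff_mul_comm, ← map_commutatorElement, QuotientGroup.mk'_apply,
      QuotientGroup.eq_one_iff]
    exact hcomm x y

instance (r : ℕ) : Finite (ShortWord r) := by
  obtain ⟨n, hn⟩ := exists_nat_gt (((r : ℝ) - 1) / 3)
  have hfin : {l : List (Fin 2 × Bool) | l.length ≤ n}.Finite := List.finite_length_le _ n
  have := hfin.to_subtype
  refine Finite.of_injective (β := {l : List (Fin 2 × Bool) | l.length ≤ n})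
    (fun w => ⟨w.1.toWord, ?_⟩) fun w w' h => ?_
  · have h : (w.1.norm : ℝ) < n := w.2.2.trans hn
    exact le_of_lt (by exact_mod_cast h)
  · exact Subtype.ext (FreeGroup.toWord_injective (congrArg Subtype.val h))

instance (L : ℕ+ → ℕ+) (n : ℕ+) : Finite (LFactor L n) := by
  have : NeZero (sparsePrime (L n)) := ⟨(sparsePrime_spec (L n)).1.ne_zero⟩
  exact Pi.finite

variable {p q : ℕ+ → ℕ} {L : ℕ+ → ℕ+} {g h : ∀ n, LFactor L n}

theorem exists_controlled (hpq : GrowthConditions p q) (x : Gamma p q L g h) :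
    ∃ N, Controlled p q g h N x := by
  have hmem : x.1 ∈ (Subgroup.closure (ambientGenerators p q L g h)).toSubmonoid := x.2
  rw [Subgroup.closure_toSubmonoid] at hmem
  obtain ⟨l, hl, hx⟩ := Submonoid.exists_list_of_mem_closure hmem
  rw [← hx]
  clear hx hmem
  induction l with
  | nil => exact ⟨0, controlled_one⟩
  | cons s l ih =>
    obtain ⟨N, hN⟩ := ih fun s hs => hl s (by simp [hs])
    rw [List.prod_cons]
    exact ⟨1 + N, (controlled_generator hpq (hl s (by simp))).mul hN⟩

theorem siteGroup_eq_bot {N : ℕ} {z : ℤ} {n : ℕ+} (hp : (N : ℤ) < |z - p n|)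
    (hq : (N : ℤ) < |z - q n|) : siteGroup p q g h N z n = ⊥ := by
  rw [siteGroup, Subgroup.closure_eq_bot_iff]
  rintro x (⟨-, hx⟩ | ⟨-, hx⟩) <;> omega

/-- The gap tends to infinity, so a bound on it leaves only finitely many summands. -/
theorem GrowthConditions.le_sub (hpq : GrowthConditions p q) (n : ℕ+) : (n : ℕ) ≤ q n - p n + 1 := by
  induction n using PNat.recOn with
  | one => simp
  | succ n ih =>
    have := hpq.q_succ n
    rw [PNat.add_coe, PNat.one_coe]
    omega

theorem isElementaryAmenable_gamma (hpq : GrowthConditions p q) :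
    IsElementaryAmenable (Gamma p q L g h) := by
  let π : Gamma p q L g h →* Multiplicative ℤ :=
    RegularWreathProduct.rightHom.comp (Subgroup.subtype _)
  have hright : ∀ x : π.ker, x.1.1.right = 1 := fun x => x.2
  refine .of_ker π ?_ .int
  let e : ∀ n : ℕ+, ℤ → π.ker →* LFactor L n := fun n z =>
    { toFun := fun x => coord L z n (fun z => x.1.1.left (.ofAdd z))
      map_one' := rfl
      map_mul' := fun x y => by
        rw [← map_mul]
        congr 1
        ext z : 1
        change x.1.1.left _ * y.1.1.left (x.1.1.right⁻¹ * _) = x.1.1.left _ * y.1.1.left _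
        rw [hright, inv_one, one_mul] }
  refine isElementaryAmenable_of_coordinates e (fun x hx => ?_) (fun x n => ?_) fun x y => ?_
  · refine Subtype.ext (Subtype.ext (RegularWreathProduct.ext ?_ (hright x)))
    have : (fun z => x.1.1.left (.ofAdd z)) = 1 :=
      coord_ext fun z n => (hx n z).trans (map_one _).symm
    exact funext fun z => congrFun this z.toAdd
  · obtain ⟨N, hN⟩ := exists_controlled hpq x.1
    refine ((Set.finite_Icc ((p n : ℤ) - N) (p n + N)).union
      (Set.finite_Icc ((q n : ℤ) - N) (q n + N))).subset fun z hz => ?_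
    by_contra hcon
    have h1 : (N : ℤ) < |z - p n| := by
      by_contra! h1
      rw [abs_le] at h1
      exact hcon (Or.inl ⟨by linarith, by linarith⟩)
    have h2 : (N : ℤ) < |z - q n| := by
      by_contra! h2
      rw [abs_le] at h2
      exact hcon (Or.inr ⟨by linarith, by linarith⟩)
    have h3 := hN.2 z n
    rw [siteGroup_eq_bot h1 h2, Subgroup.mem_bot] at h3
    exact hz h3
  · obtain ⟨M, hM⟩ := exists_controlled hpq x.1
    obtain ⟨N, hN⟩ := exists_controlled hpq y.1
    have hx := hM.mono (le_max_left M N)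
    have hy := hN.mono (le_max_right M N)
    -- For `n` beyond this bound the gap exceeds twice the radius controlling `x` and `y`, so their
    -- coordinates commute.
    refine (Set.finite_Iic (⟨2 * max M N + 1, Nat.succ_pos _⟩ : ℕ+)).subset ?_
    rintro n ⟨z, hz⟩
    by_contra hcon
    have h1 : 2 * max M N + 1 < (n : ℕ) := not_le.mp hcon
    have h2 : (n : ℕ) < q n - p n + 2 := Nat.lt_succ_of_le (hpq.le_sub n)
    have h3 : 2 * max M N < q n - p n := by
      generalize (n : ℕ) = k at h1 h2
      omega
    refine hz ?_
    rw [map_commutatorElement, commutatorElement_eq_one_iff_mul_comm]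
    exact siteGroup_comm h3 (hx.2 z n) (hy.2 z n)

end ElementaryAmenable

/-! ### Lawlessness growth of sparse wreath products -/

section LawlessnessGrowth

theorem lawlessnessGrowth_mono {G : Type*} [Group G] (S : Set G) (k : ℕ) :
    Monotone (lawlessnessGrowth S k) := fun l l' hl =>
  iSup₂_le fun w hw => le_iSup₂_of_le (f := fun w _ => complexity S w) w
    ⟨hw.1, hw.2.trans (by exact_mod_cast hl)⟩ le_rfl

theorem exists_one_le_of_not_bddAbove {f : ℕ+ → ℕ} (hf : ¬ BddAbove (Set.range f)) (B : ℕ) :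
    ∃ l, B ≤ f l := by
  by_contra! h
  exact hf ⟨B, by rintro _ ⟨l, rfl⟩; exact (h l).le⟩

/-- A predicate that holds somewhere holds at `1` or starts to hold after some index. -/
theorem eq_one_or_exists_pred {P : ℕ+ → Prop} (h : ∃ n, P n) :
    P 1 ∨ ∃ m, ¬ P m ∧ P (m + 1) := by
  by_contra! hcon
  obtain ⟨n, hn⟩ := h
  induction n using PNat.recOn with
  | one => exact hcon.1 hn
  | succ n ih => exact hcon.2 n ih hn

variable {p q : ℕ+ → ℕ} {L : ℕ+ → ℕ+} {g h : ∀ n, LFactor L n} {f : ℕ+ → ℕ}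

/-- For words of length at most `l`, take an index `n` with `L (n - 1) < c * l ≤ L n`, or `n = 1`,
where the gap is `0`. The factor `l₀` in the constant guarantees that `f` is at least `1` in the
latter case. -/
theorem dominated_lawlessnessGrowth (hpq : GrowthConditions p q)
    (hL : ∀ n, 64 * L n + 29 ≤ L (n + 1)) (hadm : IsAdmissible L g h) (hf : Monotone f)
    (hf' : ¬ BddAbove (Set.range f)) (C : ℕ+)
    (hC : ∀ m l, L m < l → q (m + 1) - p (m + 1) + 1 ≤ C * f (C * l)) (k : ℕ) :
    Dominated (lawlessnessGrowth (generators p q L g h) k) fun n => (f n : ℕ∞) := by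
  obtain ⟨c, hc⟩ := exists_complexity_le hpq hadm k
  obtain ⟨l₀, hl₀⟩ := exists_one_le_of_not_bddAbove hf' 1
  refine ⟨c * C * l₀, fun l => iSup₂_le fun w hw => ?_⟩
  have hwn : (c : ℕ) * w.norm ≤ (c * l : ℕ+) := by
    rw [PNat.mul_coe]; exact Nat.mul_le_mul_left _ hw.2
  have hex : ∃ n, c * l ≤ L n := ⟨c * l, (strictMono_of_growth hL).le_apply⟩
  obtain ⟨n, hn, hle⟩ : ∃ n, c * l ≤ L n ∧ q n - p n + 1 ≤ C * l₀ * f (c * C * l₀ * l) := by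
    rcases eq_one_or_exists_pred hex with h1 | ⟨m, hm, hm'⟩
    · refine ⟨1, h1, ?_⟩
      rw [hpq.p_one, hpq.q_one]
      have h2 : f l₀ ≤ f (c * C * l₀ * l) := hf (by
        rw [mul_comm (c * C), mul_assoc]
        exact le_mul_of_one_le_right' one_le)
      exact Nat.mul_pos (Nat.mul_pos C.pos l₀.pos) (hl₀.trans h2)
    · refine ⟨m + 1, hm', (hC m _ (not_le.mp hm)).trans (Nat.mul_le_mul ?_ (hf ?_))⟩
      · exact Nat.le_mul_of_pos_right _ l₀.pos
      · rw [← mul_assoc, mul_comm C c, mul_assoc (c * C)]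
        gcongr
        exact le_mul_of_one_le_left' one_le
  refine (hc w hw.1 n (hwn.trans (by exact_mod_cast hn))).trans ?_
  have := Nat.mul_le_mul_left (c : ℕ) hle
  rw [← mul_assoc, ← mul_assoc, ← PNat.mul_coe, ← PNat.mul_coe] at this
  exact (Nat.cast_le.mpr this).trans_eq (Nat.cast_mul _ _)

/-- For `L m ≤ l < L (m + 1)`, the hard word for `m` has length linear in `l` and complexity of the
order of the gap at `m + 1`. Values `l < L 1` are absorbed by the constant `c`, the growth being at
least `1`. -/
theorem dominated_by_lawlessnessGrowth (hpq : GrowthConditions p q)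
    (hL : ∀ n, 64 * L n + 29 ≤ L (n + 1)) (hf : Monotone f) (C : ℕ+)
    (hC : ∀ m l, L m ≤ l → l < L (m + 1) → f l ≤ C * (q (m + 1) - p (m + 1))) {k : ℕ}
    (hk : 2 ≤ k) :
    Dominated (fun n => (f n : ℕ∞)) (lawlessnessGrowth (generators p q L g h) k) := by
  set S := generators p q L g h
  let c : ℕ+ := ⟨f (L 1) + 1, Nat.succ_pos _⟩
  refine ⟨34560 * C * c, fun l => ?_⟩
  have hK : ∀ a : ℕ+, a ≤ 34560 * C * c →
      lawlessnessGrowth S k (a * l) ≤ lawlessnessGrowth S k (34560 * C * c * l) := fun a ha =>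
    lawlessnessGrowth_mono S k (mul_le_mul_left ha l)
  have hex : ∃ n, l < L n := ⟨l + 1, (PNat.lt_add_right l 1).trans_le
    (strictMono_of_growth hL).le_apply⟩
  rcases eq_one_or_exists_pred hex with h1 | ⟨m, hm, hm'⟩
  · have h2 : f l ≤ ((34560 * C * c : ℕ+) : ℕ) := by
      refine (hf h1.le).trans ((Nat.le_succ _).trans ?_)
      have h3 : c ≤ 34560 * C * c := le_mul_of_one_le_left' one_le
      exact_mod_cast h3
    calc (f l : ℕ∞) ≤ ((34560 * C * c : ℕ+) : ℕ) * 1 := by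
          rw [mul_one]; exact_mod_cast h2
      _ ≤ _ := by
          gcongr
          exact one_le_lawlessnessGrowth (by omega) _
  · rw [not_lt] at hm
    obtain ⟨w, hw, hwn, hle⟩ := exists_le_complexity (g := g) (h := h) hpq hL m
    have h2 : complexity S w ≤ lawlessnessGrowth S k (34560 * l) := by
      refine complexity_le_lawlessnessGrowth hk hw (hwn.trans ?_)
      rw [PNat.mul_coe]
      exact Nat.mul_le_mul_left _ hm
    have h3 : 8 * C ≤ 34560 * C * c := by
      calc 8 * C ≤ 34560 * C := mul_le_mul_left (by decide) C
        _ ≤ _ := le_mul_of_one_le_right' one_le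
    calc (f l : ℕ∞) ≤ ((C * (q (m + 1) - p (m + 1)) : ℕ) : ℕ∞) := by exact_mod_cast hC m l hm hm'
      _ = (C : ℕ) * ((q (m + 1) - p (m + 1) : ℕ) : ℕ∞) := Nat.cast_mul _ _
      _ ≤ (C : ℕ) * (8 * lawlessnessGrowth S k (34560 * l)) := by
          gcongr
          exact hle.trans (by gcongr)
      _ = ((8 * C : ℕ+) : ℕ) * lawlessnessGrowth S k (34560 * l) := by
          rw [PNat.mul_coe]; push_cast; rw [← mul_assoc, mul_comm (8 : ℕ∞)]
      _ ≤ _ := by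
          gcongr
          · exact h3
          · refine hK _ ?_
            rw [mul_assoc]
            exact le_mul_of_one_le_right' one_le

end LawlessnessGrowth

/-! ### Sparse wreath products with prescribed lawlessness growth -/

section Prescribed

variable {f : ℕ+ → ℕ}

/-- The least `j' ≥ 93 * j` at which `f` reaches `4 * f (93 * j)`. Minimality bounds `f` before
`j'`; `93 = 64 + 29` makes the condition on `L` hold. -/
theorem exists_next (hf : Monotone f) (hf' : ¬ BddAbove (Set.range f)) (j : ℕ+) :
    ∃ j', 93 * j ≤ j' ∧ 4 * f (93 * j) ≤ f j' ∧ ∀ l < j', f l ≤ 4 * f (93 * j) := by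
  obtain ⟨l₀, hl₀⟩ := exists_one_le_of_not_bddAbove hf' (4 * f (93 * j))
  have hex : ∃ n, 93 * j ≤ n ∧ 4 * f (93 * j) ≤ f n :=
    ⟨max (93 * j) l₀, le_max_left _ _, hl₀.trans (hf (le_max_right _ _))⟩
  refine ⟨PNat.find hex, (PNat.find_spec hex).1, (PNat.find_spec hex).2, fun l hl => ?_⟩
  have h1 := PNat.find_min hex hl
  by_cases h2 : 93 * j ≤ l
  · exact (not_le.mp fun h3 => h1 ⟨h2, h3⟩).le
  · have := hf (not_le.mp h2).le
    omega

theorem natPred_add_one (n : ℕ+) : (n + 1).natPred = n.natPred + 1 := by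
  rw [PNat.natPred_add_one]
  simp [PNat.natPred]

/-- Every unbounded nondecreasing function is matched by data for a sparse wreath product. -/
theorem exists_data (hf : Monotone f) (hf' : ¬ BddAbove (Set.range f)) :
    ∃ (p q : ℕ+ → ℕ) (L : ℕ+ → ℕ+), GrowthConditions p q ∧
      (∀ n, 64 * L n + 29 ≤ L (n + 1)) ∧
      (∀ m l, L m < l → q (m + 1) - p (m + 1) + 1 ≤ 93 * f (93 * l)) ∧
      ∀ m l, L m ≤ l → l < L (m + 1) → f l ≤ 93 * (q (m + 1) - p (m + 1)) := by
  choose next hnext₁ hnext₂ hnext₃ using exists_next hf hf'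
  obtain ⟨j₀, hj₀⟩ := exists_one_le_of_not_bddAbove hf' 1
  obtain ⟨J, hJ0, hJ⟩ : ∃ J : ℕ → ℕ+, J 0 = j₀ ∧ ∀ i, J (i + 1) = next (J i) :=
    ⟨Nat.rec j₀ fun _ j => next j, rfl, fun _ => rfl⟩
  -- `J`, `D`, `P` become `L`, `q - p` and `p`, with index `0` for `n = 1`. The gap `f (93 * J i)`
  -- lies below `f (93 * l)` for `l > J i`, and four times it bounds `f l` for `l < J (i + 1)`. The
  -- recursion for `P` is equality in the condition on `p`.
  obtain ⟨D, hD0, hD⟩ : ∃ D : ℕ → ℕ, D 0 = 0 ∧ ∀ i, D (i + 1) = f (93 * J i) :=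
    ⟨Nat.rec 0 fun i _ => f (93 * J i), rfl, fun _ => rfl⟩
  obtain ⟨P, hP0, hP⟩ : ∃ P : ℕ → ℕ, P 0 = 0 ∧ ∀ i, P (i + 1) = 2 * P i + D i + 1 :=
    ⟨Nat.rec 0 fun i x => 2 * x + D i + 1, rfl, fun _ => rfl⟩
  have hJ93 : ∀ j : ℕ+, j ≤ 93 * j := fun j => le_mul_of_one_le_left' one_le
  have hD1 : ∀ i, 1 ≤ D (i + 1) := fun i => by
    induction i with
    | zero =>
      rw [hD, hJ0]
      exact hj₀.trans (hf (hJ93 _))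
    | succ i ih =>
      have h1 := hnext₂ (J i)
      have h2 := hf (hJ93 (J (i + 1)))
      have h3 := hD i
      have h4 := hD (i + 1)
      rw [hJ] at h2 h4
      omega
  -- Quadrupling of nonzero values gives this. It keeps `P i ≤ D i`, from which the condition on
  -- `q`, namely `P i + D i + 1 ≤ D (i + 1)`, follows.
  have hD4 : ∀ i, 3 * D i + 1 ≤ D (i + 1) := fun i => by
    cases i with
    | zero => rw [hD0]; exact hD1 0
    | succ i =>
      have h0 := hD1 i
      have h1 := hnext₂ (J i)
      have h2 := hf (hJ93 (J (i + 1)))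
      have h3 := hD i
      have h4 := hD (i + 1)
      rw [hJ] at h2 h4
      omega
  have hPD : ∀ i, P i ≤ D i := fun i => by
    induction i with
    | zero => rw [hP0]; exact Nat.zero_le _
    | succ i ih =>
      have := hD4 i
      rw [hP]
      omega
  have hmono : ∀ r : ℕ → ℕ, (∀ i, r i ≤ r (i + 1)) → Monotone fun n : ℕ+ => r n.natPred :=
    fun r hr a b hab => monotone_nat_of_le_succ hr (PNat.natPred_le_natPred.mpr hab)
  refine ⟨fun n => P n.natPred, fun n => P n.natPred + D n.natPred, fun n => J n.natPred,
    ⟨hmono P fun i => ?_, hmono (fun i => P i + D i) fun i => ?_, hP0,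
      by change P 0 + D 0 = 0; rw [hP0, hD0], fun n => ?_, fun n => ?_⟩, fun n => ?_, fun m l hl => ?_, fun m l hl hl' => ?_⟩
  · rw [hP]; omega
  · have := hD4 i
    rw [hP]; omega
  · rw [natPred_add_one, hP]; omega
  · have h1 := hD4 n.natPred
    have h2 := hPD n.natPred
    rw [natPred_add_one]
    omega
  · dsimp only
    rw [natPred_add_one, hJ]
    refine le_trans ?_ (hnext₁ _)
    rw [← PNat.coe_le_coe]
    push_cast
    have := (J n.natPred).pos
    change 64 * (J n.natPred : ℕ) + 29 ≤ 93 * (J n.natPred : ℕ)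
    omega
  · have h1 := hD1 m.natPred
    have h2 : f (93 * J m.natPred) ≤ f (93 * l) := hf (mul_le_mul_right hl.le _)
    dsimp only
    rw [natPred_add_one]
    rw [hD] at h1 ⊢
    omega
  · dsimp only at hl' ⊢
    rw [natPred_add_one, hJ] at hl'
    have := hnext₃ _ l hl'
    rw [natPred_add_one, hD]
    omega

theorem finite_generators (p q : ℕ+ → ℕ) (L : ℕ+ → ℕ+) (g h : ∀ n, LFactor L n) :
    (generators p q L g h).Finite := by
  have : (ambientGenerators p q L g h).Finite := by simp [ambientGenerators]
  exact this.preimage Subtype.val_injective.injOn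

theorem closure_generators (p q : ℕ+ → ℕ) (L : ℕ+ → ℕ+) (g h : ∀ n, LFactor L n) :
    Subgroup.closure (generators p q L g h) = ⊤ :=
  Subgroup.closure_closure_coe_preimage

end Prescribed

end SparseWreath

open SparseWreath in
theorem mainTheorem5
    (p q : ℕ+ → ℕ) (hpq : SparseWreath.GrowthConditions p q)
    (L : ℕ+ → ℕ+) (hL : ∀ n, 64 * L n + 29 ≤ L (n + 1))
    (f : ℕ+ → ℕ) (hf_mono : Monotone f) (hf_unbdd : ¬ BddAbove (Set.range f))
    (K C : ℕ+)
    (h_i : ∀ m : ℕ+, 2 ≤ m →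
      (f (L (m + 1)) : ℝ) ≤ ((K : ℕ) : ℝ) * ((q (K * m) : ℝ) - (p (K * m) : ℝ)) / 2)
    (h_ii : ∀ m : ℕ+,
      2 * ((q (m + 1) : ℝ) - (p (m + 1) : ℝ) + 1) ≤ ((C : ℕ) : ℝ) * (f (C * L m) : ℝ)) :
    -- the elements from which `Γ(L)` is built exist
    (∃ g h : ∀ n, SparseWreath.LFactor L n, SparseWreath.IsAdmissible L g h) ∧
    -- the group `Γ(L)` itself, for every choice of these elements
    (∀ g h : ∀ n, SparseWreath.LFactor L n, SparseWreath.IsAdmissible L g h →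
      SparseWreath.IsElementaryAmenable (SparseWreath.Gamma p q L g h) ∧
      SparseWreath.IsLawless (SparseWreath.Gamma p q L g h) ∧
      (∀ k : ℕ, 2 ≤ k →
        SparseWreath.Dominated
          (SparseWreath.lawlessnessGrowth (SparseWreath.generators p q L g h) k)
          (fun n => (f n : ℕ∞))) ∧
      ((∃ K' : ℕ+, ∀ m : ℕ+, 2 ≤ m →
          (f (L (m + 1)) : ℝ) ≤ ((K' : ℕ) : ℝ) * ((q m : ℝ) - (p m : ℝ)) / 2) →
        ∀ k : ℕ, 2 ≤ k →
          SparseWreath.GrowthEquiv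
            (SparseWreath.lawlessnessGrowth (SparseWreath.generators p q L g h) k)
            (fun n => (f n : ℕ∞)))) ∧
    -- a sparse wreath product whose lawlessness growth is equivalent to `f`
    (∃ (p' q' : ℕ+ → ℕ) (L' : ℕ+ → ℕ+) (g h : ∀ n, SparseWreath.LFactor L' n),
      SparseWreath.GrowthConditions p' q' ∧
      (∀ n, 64 * L' n + 29 ≤ L' (n + 1)) ∧
      SparseWreath.IsAdmissible L' g h ∧
      (SparseWreath.generators p' q' L' g h).Finite ∧
      Subgroup.closure (SparseWreath.generators p' q' L' g h) = ⊤ ∧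
      SparseWreath.IsElementaryAmenable (SparseWreath.Gamma p' q' L' g h) ∧
      SparseWreath.IsLawless (SparseWreath.Gamma p' q' L' g h) ∧
      ∀ k : ℕ, 2 ≤ k →
        SparseWreath.GrowthEquiv
          (SparseWreath.lawlessnessGrowth (SparseWreath.generators p' q' L' g h) k)
          (fun n => (f n : ℕ∞))) := by
  have hle : ∀ n, (p n : ℝ) ≤ q n := fun n => by exact_mod_cast hpq.p_le_q n
  refine ⟨exists_isAdmissible L, fun g h hadm => ?_, ?_⟩
  · have hupper : ∀ k, Dominated (lawlessnessGrowth (generators p q L g h) k)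
        (fun n => (f n : ℕ∞)) := fun k => by
      refine dominated_lawlessnessGrowth hpq hL hadm hf_mono hf_unbdd C (fun m l hl => ?_) k
      have h1 := h_ii m
      have h2 : q (m + 1) - p (m + 1) + 1 ≤ C * f (C * L m) := by
        rw [← Nat.cast_le (α := ℝ)]
        push_cast [Nat.cast_sub (hpq.p_le_q (m + 1))]
        linarith [hle (m + 1)]
      exact h2.trans (Nat.mul_le_mul_left _ (hf_mono (mul_le_mul_right hl.le _)))
    refine ⟨isElementaryAmenable_gamma hpq, isLawless_gamma hpq hL hadm, fun k _ => hupper k, ?_⟩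
    rintro ⟨K', hK'⟩ k hk
    -- The assumption on `K'` starts at `m = 2`. The extra summand `f (L 2) + 1` covers `m = 1`,
    -- where the gap at `2` is at least `1`.
    refine ⟨hupper k, dominated_by_lawlessnessGrowth hpq hL hf_mono
      (K' + (f (L 2)).succPNat) (fun m l _ hl => ?_) hk⟩
    refine (hf_mono hl.le).trans ?_
    rw [PNat.add_coe, Nat.succPNat_coe, add_mul]
    by_cases hm : m = 1
    · subst hm
      have h1 := hpq.le_sub (1 + 1)
      have h2 : 1 ≤ q (1 + 1) - p (1 + 1) := by
        rw [PNat.add_coe, PNat.one_coe] at h1; omega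
      change f (L 2) ≤ _
      nlinarith [Nat.zero_le (K' * (q (1 + 1) - p (1 + 1)))]
    · have h1 := hK' m (PNat.add_one_le_iff.mpr (lt_of_le_of_ne one_le (Ne.symm hm)))
      have h2 := hpq.monotone_sub (le_of_lt (PNat.lt_add_right m 1))
      have h3 : f (L (m + 1)) ≤ K' * (q m - p m) := by
        rw [← Nat.cast_le (α := ℝ)]
        push_cast [Nat.cast_sub (hpq.p_le_q m)]
        have : 0 ≤ ((K' : ℕ) : ℝ) * ((q m : ℝ) - p m) :=
          mul_nonneg (Nat.cast_nonneg _) (sub_nonneg.mpr (hle m))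
        linarith
      exact (h3.trans (Nat.mul_le_mul_left _ h2)).trans (Nat.le_add_right _ _)
  · obtain ⟨p', q', L', hpq', hL', hup, hlow⟩ := exists_data hf_mono hf_unbdd
    obtain ⟨g, h, hadm⟩ := exists_isAdmissible L'
    exact ⟨p', q', L', g, h, hpq', hL', hadm, finite_generators _ _ _ _ _,
      closure_generators _ _ _ _ _, isElementaryAmenable_gamma hpq', isLawless_gamma hpq' hL' hadm,
      fun k hk => ⟨dominated_lawlessnessGrowth hpq' hL' hadm hf_mono hf_unbdd 93 hup k,
        dominated_by_lawlessnessGrowth hpq' hL' hf_mono 93 hlow hk⟩⟩
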